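/- Let $\eta\in\mathbb C\setminus\{0\}$ and $c,\bar c,\bar\eta\in\mathbb C$ with $c+\bar c=28$ and $\eta+\bar\eta=0$. The algebra $W_2$ with central charges $(c,\eta)$ has generators $\mathcal L_n,a_n$ ($n\in\mathbb Z$) and relations $$[\mathcal L_n,\mathcal L_m]=(n-m)\mathcal L_{n+m}+\tfrac{c}{12}(n^3-n)\delta_{n,-m},\quad [a_n,a_m]=2\eta\,n\,\delta_{n+m,0},\quad [\mathcal L_n,a_m]=-m\,a_{n+m}.$$ Let $W$ and $\bar W$ be complex representations of $W_2$ with central charges $(c,\eta)$ and $(\bar c,\bar\eta)$, each smooth (every vector is annihilated by all generators of sufficiently large index), with fields $\mathcal L(z)=\sum\mathcal L_nz^{-n-2}$, $a(z)=\sum a_nz^{-n-1}$ and $\bar{\mathcal L}(z),\bar a(z)$. Let $M$ be the Fock space of the fermionic ghosts $b(z)=\sum b_nz^{-n-2}$, $c(z)=\sum c_nz^{-n+1}$, $\psi(z)=\sum\psi_nz^{-n}$, $\chi(z)=\sum\chi_nz^{-n-1}$, where $\{b_n,c_m\}=\{\psi_n,\chi_m\}=\delta_{n+m,0}$, all other anticommutators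 vanish, and the vacuum is annihilated by $b_k$ ($k\ge-1$), $c_k$ ($k\ge2$), $\psi_k$ ($k\ge1$), $\chi_k$ ($k\ge0$). On $W\otimes\bar W\otimes M$ put $a^{\pm}(z)=a(z)\pm\bar a(z)$, $$Q=\int\frac{dz}{2\pi i}\Big(:c(\mathcal L+\bar{\mathcal L}):+:c\,\partial c\,b:+\tfrac32\partial^2c+\psi a^++:c\,\partial\psi\,\chi:\Big),\qquad R=\frac1{8\eta\pi i}\int dz\;c(z)a^-(z)\chi(z),$$ $$L(z)=\mathcal L(z)-\frac1{4\eta}:a(z)^2:,\qquad \bar L(z)=\bar{\mathcal L}(z)-\frac1{4\bar\eta}:\bar a(z)^2:\;=\bar{\mathcal L}(z)+\frac1{4\eta}:\bar a(z)^2:,$$ where $\int dz$ is $2\pi i$ times the residue. Then every vector is annihilated by some power of $R$, so that $e^{\pm R}$ are well defined, and with $\tilde A(z)=e^{R}A(z)e^{-R}$ for each field $A$, $$Q=\int\frac{dz}{2\pi i}\Big(:\tilde c(L+\bar L):+:\tilde c\,\partial\tilde c\,\tilde b:+\tfrac32\partial^2\tilde c+\tilde\psi\,\tilde a^+\Big).$$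 Moreover the fields $L$ and $a$ are decoupled: $[L_n,a_m]=0$, the $a_n$ satisfy $[a_n,a_m]=2\eta\,n\,\delta_{n+m,0}$, and the $L_n$ satisfy the Virasoro relations with central charge $c-1$; likewise for $\bar L,\bar a$ with $\bar c-1$ and $\bar\eta$. -/

import Mathlib

open scoped TensorProduct

noncomputable section

namespace W2BRST

variable {V W : Type*} [AddCommGroup V] [Module ℂ V] [AddCommGroup W] [Module ℂ W]

/-! ### Fields

A field on `V` is a formal series `A(z) = ∑ₖ A⁽ᵏ⁾ zᵏ` of operators on `V` such that `A(z) v` is a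
Laurent series for every vector `v`, i.e. a `VertexOperator ℂ V`; `HVertexOperator.coeff A k` is the
coefficient of `zᵏ`. -/

/-- A family of modes is smooth if every vector is annihilated by all modes of large index. -/
def IsSmooth (A : ℤ → Module.End ℂ V) : Prop :=
  ∀ v, ∃ N : ℤ, ∀ n, N ≤ n → A n v = 0

/-- The field `A(z) = ∑ₙ Aₙ z^(-n-h)` with modes `Aₙ` and conformal weight `h`. -/
def fieldOfModes (h : ℤ) (A : ℤ → Module.End ℂ V) (hA : IsSmooth A) : VertexOperator ℂ V :=
  VertexOperator.of_coeff (fun k ↦ A (-k - h)) fun v ↦ by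
    obtain ⟨N, hN⟩ := hA v
    refine ⟨-N - h, fun k hk ↦ ?_⟩
    by_contra hlt
    exact hk (hN _ (by omega))

/-- The mode `Aₙ` of a field `A(z) = ∑ₙ Aₙ z^(-n-h)` of conformal weight `h`. -/
def mode (h : ℤ) (A : VertexOperator ℂ V) (n : ℤ) : Module.End ℂ V :=
  HVertexOperator.coeff A (-n - h)

/-- Each Laurent series `A(z) v` has only finitely many terms of negative degree. -/
theorem coeff_lower_bound (A : VertexOperator ℂ V) (v : V) :
    ∃ N : ℤ, ∀ k, k < N → HVertexOperator.coeff A k v = 0 :=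
  ⟨_, fun k hk ↦ VertexOperator.coeff_eq_zero_of_lt_order A k v hk⟩

/-- The derivative `∂A(z)`. -/
def deriv (A : VertexOperator ℂ V) : VertexOperator ℂ V :=
  VertexOperator.of_coeff (fun k ↦ ((k : ℂ) + 1) • HVertexOperator.coeff A (k + 1)) fun v ↦ by
    obtain ⟨N, hN⟩ := coeff_lower_bound A v
    refine ⟨N - 1, fun k hk ↦ ?_⟩
    by_contra hlt
    exact hk (by simp only [LinearMap.smul_apply, hN _ (show k + 1 < N by omega), smul_zero])

/-- The `i`-th summand of the coefficient of `zᵏ` in a normally ordered product. -/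
def normalTerm (s : ℂ) (A B : VertexOperator ℂ V) (k i : ℤ) : Module.End ℂ V :=
  if 0 ≤ i then HVertexOperator.coeff A i * HVertexOperator.coeff B (k - i)
  else s • (HVertexOperator.coeff B (k - i) * HVertexOperator.coeff A i)

theorem normalTerm_eq_zero (s : ℂ) (A B : VertexOperator ℂ V) (v : V) :
    ∃ N : ℤ, ∀ k i, (i < N ∨ k - N < i) → normalTerm s A B k i v = 0 := by
  obtain ⟨NA, hA⟩ := coeff_lower_bound A v
  obtain ⟨NB, hB⟩ := coeff_lower_bound B v
  have key : ∀ m : ℤ, ∃ N : ℤ, ∀ i, m ≤ i → i < 0 → ∀ k, k < N →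
      HVertexOperator.coeff B k (HVertexOperator.coeff A i v) = 0 := by
    intro m
    induction hm : (-m).toNat generalizing m with
    | zero => exact ⟨0, fun i h1 h2 ↦ by omega⟩
    | succ d ih =>
      obtain ⟨N, hN⟩ := ih (m + 1) (by omega)
      obtain ⟨N', hN'⟩ := coeff_lower_bound B (HVertexOperator.coeff A m v)
      refine ⟨min N N', fun i h1 h2 k hk ↦ ?_⟩
      rcases eq_or_lt_of_le h1 with rfl | h
      · exact hN' k (by omega)
      · exact hN i (by omega) h2 k (by omega)
  obtain ⟨N, hN⟩ := key NA
  refine ⟨min (min NA NB) (min N 0), fun k i hi ↦ ?_⟩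
  unfold normalTerm
  split_ifs with h0
  · rw [Module.End.mul_apply, hB _ (by omega), map_zero]
  · rw [LinearMap.smul_apply, Module.End.mul_apply]
    by_cases h1 : i < NA
    · rw [hA i h1, map_zero, smul_zero]
    · rw [hN i (by omega) (by omega) _ (by omega), smul_zero]

theorem normalTerm_finite (s : ℂ) (A B : VertexOperator ℂ V) (k : ℤ) (v : V) :
    (Function.support fun i ↦ normalTerm s A B k i v).Finite := by
  obtain ⟨N, hN⟩ := normalTerm_eq_zero s A B v
  refine (Set.finite_Icc N (k - N)).subset fun i hi ↦ ?_
  by_contra h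
  refine hi (hN k i ?_)
  simp only [Set.mem_Icc, not_and_or, not_le] at h
  exact h

/-- The normally ordered product `:A(z)B(z): = A(z)₊ B(z) + s B(z) A(z)₋`, where `A(z)₊` collects
the powers `zⁱ` with `i ≥ 0` and `A(z)₋` those with `i < 0`; the sign `s` is `-1` if `A` and `B` are
both fermionic and `1` otherwise. If `A` and `B` (anti)commute, this is the plain product
`A(z)B(z)`. The sum over `i` is finite on every vector (`normalTerm_finite`). -/
def normalProd (s : ℂ) (A B : VertexOperator ℂ V) : VertexOperator ℂ V :=
  VertexOperator.of_coeff
    (fun k ↦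
      { toFun := fun v ↦ ∑ᶠ i, normalTerm s A B k i v
        map_add' := fun u v ↦ by
          simp only [map_add]
          exact finsum_add_distrib (normalTerm_finite s A B k u) (normalTerm_finite s A B k v)
        map_smul' := fun r v ↦ by
          simp only [map_smul, RingHom.id_apply]
          exact (smul_finsum' r (normalTerm_finite s A B k v)).symm })
    fun v ↦ by
      obtain ⟨N, hN⟩ := normalTerm_eq_zero s A B v
      refine ⟨N + N, fun k hk ↦ ?_⟩
      by_contra hlt
      refine hk ?_
      change ∑ᶠ i, normalTerm s A B k i v = 0
      rw [finsum_congr fun i ↦ hN k i (by omega), finsum_zero]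

/-- The formal contour integral `∫ dz A(z) = 2πi Res A(z)`. -/
def contourIntegral (A : VertexOperator ℂ V) : Module.End ℂ V :=
  (2 * Real.pi * Complex.I : ℂ) • HVertexOperator.coeff A (-1)

/-! ### Exponentials and conjugation -/

/-- Every vector is annihilated by a power of `R`. -/
def IsLocallyNilpotent (R : Module.End ℂ V) : Prop :=
  ∀ v, ∃ n : ℕ, (R ^ n) v = 0

theorem IsLocallyNilpotent.finite {R : Module.End ℂ V} (hR : IsLocallyNilpotent R) (v : V) :
    (Function.support fun n : ℕ ↦ ((n.factorial : ℂ)⁻¹) • (R ^ n) v).Finite := by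
  obtain ⟨N, hN⟩ := hR v
  refine (Set.finite_Iio N).subset fun n hn ↦ ?_
  by_contra h
  refine hn ?_
  have h' : n = (n - N) + N := by simp only [Set.mem_Iio, not_lt] at h; omega
  change ((n.factorial : ℂ)⁻¹) • (R ^ n) v = 0
  rw [h', pow_add, Module.End.mul_apply, hN, map_zero, smul_zero]

open Classical in
/-- The exponential `e^R = ∑ₙ Rⁿ / n!` of a locally nilpotent operator (a finite sum on every
vector); the value for other operators is `0` and of no significance. -/
def expOp (R : Module.End ℂ V) : Module.End ℂ V :=
  if hR : IsLocallyNilpotent R then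
    { toFun := fun v ↦ ∑ᶠ n : ℕ, ((n.factorial : ℂ)⁻¹) • (R ^ n) v
      map_add' := fun u v ↦ by
        simp only [map_add, smul_add]
        exact finsum_add_distrib (hR.finite u) (hR.finite v)
      map_smul' := fun r v ↦ by
        simp only [map_smul, RingHom.id_apply]
        rw [smul_finsum' r (hR.finite v)]
        exact finsum_congr fun n ↦ smul_comm _ _ _ }
  else 0

/-- The conjugated field `e^R A(z) e^(-R)`. -/
def conj (R : Module.End ℂ V) (A : VertexOperator ℂ V) : VertexOperator ℂ V :=
  VertexOperator.of_coeff (fun k ↦ expOp R * HVertexOperator.coeff A k * expOp (-R)) fun v ↦ by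
    obtain ⟨N, hN⟩ := coeff_lower_bound A (expOp (-R) v)
    refine ⟨N, fun k hk ↦ ?_⟩
    by_contra hlt
    exact hk (by simp only [Module.End.mul_apply, hN k (by omega), map_zero])

/-! ### Modules over `W₂` -/

/-- A smooth representation on `W` of the algebra `W₂`, the semi-direct sum of the Virasoro and the
Heisenberg algebra, with central charges `(c, η)`. -/
structure W2Module (c η : ℂ) (W : Type*) [AddCommGroup W] [Module ℂ W] where
  /-- the Virasoro generators -/
  L : ℤ → Module.End ℂ W
  /-- the Heisenberg generators -/
  a : ℤ → Module.End ℂ W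
  comm_L_L : ∀ n m : ℤ, ⁅L n, L m⁆ = ((n : ℂ) - m) • L (n + m) +
    (if n + m = 0 then c / 12 * ((n : ℂ) ^ 3 - n) else 0) • (1 : Module.End ℂ W)
  comm_a_a : ∀ n m : ℤ, ⁅a n, a m⁆ =
    (if n + m = 0 then 2 * η * (n : ℂ) else 0) • (1 : Module.End ℂ W)
  comm_L_a : ∀ n m : ℤ, ⁅L n, a m⁆ = (-(m : ℂ)) • a (n + m)
  smooth_L : IsSmooth L
  smooth_a : IsSmooth a

/-- The fields `L(z) = ∑ₙ Lₙ z^(-n-2)` and `a(z) = ∑ₙ aₙ z^(-n-1)` generate the direct sum of the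
Virasoro algebra with central charge `c` and the Heisenberg algebra of level `2η`. -/
structure IsVirasoroHeisenberg (c η : ℂ) (L a : VertexOperator ℂ V) : Prop where
  comm_L_L : ∀ n m : ℤ, ⁅mode 2 L n, mode 2 L m⁆ = ((n : ℂ) - m) • mode 2 L (n + m) +
    (if n + m = 0 then c / 12 * ((n : ℂ) ^ 3 - n) else 0) • (1 : Module.End ℂ V)
  comm_a_a : ∀ n m : ℤ, ⁅mode 1 a n, mode 1 a m⁆ =
    (if n + m = 0 then 2 * η * (n : ℂ) else 0) • (1 : Module.End ℂ V)
  comm_L_a : ∀ n m : ℤ, ⁅mode 2 L n, mode 1 a m⁆ = 0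

/-- The field `L(z) = 𝓛(z) - (1/4η) :a(z)²:`. -/
def decoupled (η : ℂ) (T a : VertexOperator ℂ V) : VertexOperator ℂ V :=
  T - (1 / (4 * η)) • normalProd 1 a a

/-! ### The ghost Fock space

The Fock space `M = Λ ⊗ Λ'` of the ghosts `b, c` and `ψ, χ` is the exterior algebra on the span of
the creation modes, with vacuum `1`. The basis vector with label `inl n` is `bₙ` for `n ≤ -2` and
`c₋ₙ` for `n ≥ -1`; the one with label `inr n` is `χₙ` for `n ≤ -1` and `ψ₋ₙ` for `n ≥ 0`. Creation
modes act by exterior multiplication and annihilation modes by contraction with the dual basis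
vector of the conjugate creation mode. -/

/-- The Fock space `M = Λ ⊗ Λ'` of the four ghost fields. -/
abbrev GhostFock : Type := ExteriorAlgebra ℂ ((ℤ ⊕ ℤ) →₀ ℂ)

/-- Exterior multiplication by a basis vector. -/
def create (i : ℤ ⊕ ℤ) : Module.End ℂ GhostFock :=
  LinearMap.mulLeft ℂ (ExteriorAlgebra.ι ℂ (Finsupp.single i 1))

/-- Contraction with a dual basis vector. -/
def annihilate (i : ℤ ⊕ ℤ) : Module.End ℂ GhostFock :=
  CliffordAlgebra.contractLeft (Finsupp.lapply i)

def bGhost (n : ℤ) : Module.End ℂ GhostFock :=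
  if n ≤ -2 then create (.inl n) else annihilate (.inl n)

def cGhost (n : ℤ) : Module.End ℂ GhostFock :=
  if n ≤ 1 then create (.inl (-n)) else annihilate (.inl (-n))

def chiGhost (n : ℤ) : Module.End ℂ GhostFock :=
  if n ≤ -1 then create (.inr n) else annihilate (.inr n)

def psiGhost (n : ℤ) : Module.End ℂ GhostFock :=
  if n ≤ 0 then create (.inr (-n)) else annihilate (.inr (-n))

/-- A vector of the Fock space involves only finitely many modes. -/
theorem annihilate_eq_zero (x : GhostFock) :
    ∃ S : Finset (ℤ ⊕ ℤ), ∀ i, i ∉ S → annihilate i x = 0 := by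
  classical
  induction x using CliffordAlgebra.left_induction with
  | algebraMap r =>
    refine ⟨∅, fun i _ ↦ ?_⟩
    unfold annihilate
    rw [CliffordAlgebra.contractLeft_algebraMap]
  | add x y hx hy =>
    obtain ⟨S, hS⟩ := hx
    obtain ⟨T, hT⟩ := hy
    refine ⟨S ∪ T, fun i hi ↦ ?_⟩
    rw [Finset.mem_union, not_or] at hi
    rw [map_add, hS i hi.1, hT i hi.2, add_zero]
  | ι_mul x m hx =>
    obtain ⟨S, hS⟩ := hx
    refine ⟨S ∪ m.support, fun i hi ↦ ?_⟩
    rw [Finset.mem_union, not_or, Finsupp.notMem_support_iff] at hi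
    have h := hS i hi.1
    unfold annihilate at h ⊢
    rw [CliffordAlgebra.contractLeft_ι_mul, h, Finsupp.lapply_apply, hi.2, zero_smul, mul_zero,
      sub_zero]

/-- Modes that are eventually pairwise different annihilation modes are smooth. -/
theorem isSmooth_of_annihilate (A : ℤ → Module.End ℂ GhostFock) (j : ℤ → ℤ ⊕ ℤ)
    (hj : Function.Injective j) (N : ℤ) (h : ∀ n, N ≤ n → A n = annihilate (j n)) :
    IsSmooth A := by
  intro x
  obtain ⟨S, hS⟩ := annihilate_eq_zero x
  obtain ⟨B, hB⟩ := (S.finite_toSet.preimage hj.injOn).bddAbove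
  refine ⟨max N (B + 1), fun n hn ↦ ?_⟩
  rw [h n (by omega)]
  refine hS _ fun hmem ↦ ?_
  have := hB (show n ∈ j ⁻¹' (S : Set (ℤ ⊕ ℤ)) from hmem)
  omega

theorem smooth_bGhost : IsSmooth bGhost :=
  isSmooth_of_annihilate _ (fun n ↦ .inl n) (fun _ _ h ↦ Sum.inl_injective h) (-1)
    fun n hn ↦ if_neg (by omega)

theorem smooth_cGhost : IsSmooth cGhost :=
  isSmooth_of_annihilate _ (fun n ↦ .inl (-n)) (fun _ _ h ↦ neg_injective (Sum.inl_injective h)) 2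
    fun n hn ↦ if_neg (by omega)

theorem smooth_chiGhost : IsSmooth chiGhost :=
  isSmooth_of_annihilate _ (fun n ↦ .inr n) (fun _ _ h ↦ Sum.inr_injective h) 0
    fun n hn ↦ if_neg (by omega)

theorem smooth_psiGhost : IsSmooth psiGhost :=
  isSmooth_of_annihilate _ (fun n ↦ .inr (-n)) (fun _ _ h ↦ neg_injective (Sum.inr_injective h)) 1
    fun n hn ↦ if_neg (by omega)

/-! ### Fields on the complex `(W ⊗ W̄) ⊗ M` -/

theorem IsSmooth.rTensor {A : ℤ → Module.End ℂ V} (hA : IsSmooth A) :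
    IsSmooth fun n ↦ (A n).rTensor W := by
  intro x
  induction x with
  | zero => exact ⟨0, fun n _ ↦ map_zero _⟩
  | tmul v w =>
    obtain ⟨N, hN⟩ := hA v
    exact ⟨N, fun n hn ↦ by rw [LinearMap.rTensor_tmul, hN n hn, TensorProduct.zero_tmul]⟩
  | add x y hx hy =>
    obtain ⟨N, hN⟩ := hx
    obtain ⟨N', hN'⟩ := hy
    exact ⟨max N N', fun n hn ↦ by rw [map_add, hN n (by omega), hN' n (by omega), add_zero]⟩

theorem IsSmooth.lTensor {A : ℤ → Module.End ℂ V} (hA : IsSmooth A) :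
    IsSmooth fun n ↦ (A n).lTensor W := by
  intro x
  induction x with
  | zero => exact ⟨0, fun n _ ↦ map_zero _⟩
  | tmul w v =>
    obtain ⟨N, hN⟩ := hA v
    exact ⟨N, fun n hn ↦ by rw [LinearMap.lTensor_tmul, hN n hn, TensorProduct.tmul_zero]⟩
  | add x y hx hy =>
    obtain ⟨N, hN⟩ := hx
    obtain ⟨N', hN'⟩ := hy
    exact ⟨max N N', fun n hn ↦ by rw [map_add, hN n (by omega), hN' n (by omega), add_zero]⟩

/-- The semi-infinite cohomology complex of the `W₂`-module `W ⊗ W̄`. -/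
abbrev SemiInfComplex (W W' : Type*) [AddCommGroup W] [Module ℂ W] [AddCommGroup W'] [Module ℂ W'] :
    Type _ :=
  (W ⊗[ℂ] W') ⊗[ℂ] GhostFock

section Fields

variable (W W' : Type*) [AddCommGroup W] [Module ℂ W] [AddCommGroup W'] [Module ℂ W']

/-- The field of weight `h` on the complex whose modes act on the first factor `W`. -/
def fieldLeft (h : ℤ) (A : ℤ → Module.End ℂ W) (hA : IsSmooth A) :
    VertexOperator ℂ (SemiInfComplex W W') :=
  fieldOfModes h (fun n ↦ ((A n).rTensor W').rTensor GhostFock) hA.rTensor.rTensor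

/-- The field of weight `h` on the complex whose modes act on the second factor `W̄`. -/
def fieldRight (h : ℤ) (A : ℤ → Module.End ℂ W') (hA : IsSmooth A) :
    VertexOperator ℂ (SemiInfComplex W W') :=
  fieldOfModes h (fun n ↦ ((A n).lTensor W).rTensor GhostFock) hA.lTensor.rTensor

/-- The field of weight `h` on the complex whose modes act on the ghost Fock space. -/
def fieldGhost (h : ℤ) (A : ℤ → Module.End ℂ GhostFock) (hA : IsSmooth A) :
    VertexOperator ℂ (SemiInfComplex W W') :=
  fieldOfModes h (fun n ↦ (A n).lTensor (W ⊗[ℂ] W')) hA.lTensor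

/-- `b(z) = ∑ₙ bₙ z^(-n-2)`. -/
def bField : VertexOperator ℂ (SemiInfComplex W W') := fieldGhost W W' 2 bGhost smooth_bGhost

/-- `c(z) = ∑ₙ cₙ z^(-n+1)`. -/
def cField : VertexOperator ℂ (SemiInfComplex W W') := fieldGhost W W' (-1) cGhost smooth_cGhost

/-- `ψ(z) = ∑ₙ ψₙ z^(-n)`. -/
def psiField : VertexOperator ℂ (SemiInfComplex W W') := fieldGhost W W' 0 psiGhost smooth_psiGhost

/-- `χ(z) = ∑ₙ χₙ z^(-n-1)`. -/
def chiField : VertexOperator ℂ (SemiInfComplex W W') := fieldGhost W W' 1 chiGhost smooth_chiGhost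

end Fields

/-- The BRST current of the semi-direct sum,
`:cT: + :c∂cb: + (3/2)∂²c + ψa + :c∂ψχ:`. -/
def currentSemidirect (T a b c ψ χ : VertexOperator ℂ V) : VertexOperator ℂ V :=
  normalProd 1 c T + normalProd 1 c (normalProd (-1) (deriv c) b) +
    (3 / 2 : ℂ) • deriv (deriv c) + normalProd 1 ψ a + normalProd 1 c (normalProd (-1) (deriv ψ) χ)

/-- The BRST current of the direct sum of the Virasoro and the Heisenberg algebra,
`:cT: + :c∂cb: + (3/2)∂²c + ψa`. -/
def currentDirect (T a b c ψ : VertexOperator ℂ V) : VertexOperator ℂ V :=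
  normalProd 1 c T + normalProd 1 c (normalProd (-1) (deriv c) b) +
    (3 / 2 : ℂ) • deriv (deriv c) + normalProd 1 ψ a

section Operators

variable {W W' : Type*} [AddCommGroup W] [Module ℂ W] [AddCommGroup W'] [Module ℂ W']
  {c₁ η₁ c₂ η₂ : ℂ} (ρ : W2Module c₁ η₁ W) (ρ' : W2Module c₂ η₂ W')

/-- `𝓛(z)`. -/
def LField : VertexOperator ℂ (SemiInfComplex W W') := fieldLeft W W' 2 ρ.L ρ.smooth_L

/-- `a(z)`. -/
def aField : VertexOperator ℂ (SemiInfComplex W W') := fieldLeft W W' 1 ρ.a ρ.smooth_a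

/-- `𝓛̄(z)`. -/
def LbarField : VertexOperator ℂ (SemiInfComplex W W') := fieldRight W W' 2 ρ'.L ρ'.smooth_L

/-- `ā(z)`. -/
def abarField : VertexOperator ℂ (SemiInfComplex W W') := fieldRight W W' 1 ρ'.a ρ'.smooth_a

/-- `a⁺(z) = a(z) + ā(z)`. -/
def aPlus : VertexOperator ℂ (SemiInfComplex W W') := aField ρ + abarField ρ'

/-- `a⁻(z) = a(z) - ā(z)`. -/
def aMinus : VertexOperator ℂ (SemiInfComplex W W') := aField ρ - abarField ρ'

/-- The BRST operator `Q = ∫ dz/(2πi) J(z)` on the complex. -/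
def brst : Module.End ℂ (SemiInfComplex W W') :=
  (2 * Real.pi * Complex.I : ℂ)⁻¹ • contourIntegral
    (currentSemidirect (LField ρ + LbarField ρ') (aPlus ρ ρ') (bField W W') (cField W W')
      (psiField W W') (chiField W W'))

/-- `R = (8ηπi)⁻¹ ∫ dz c(z) a⁻(z) χ(z)`, where `(c₁, η)` are the central charges of `W`. -/
def conjR : Module.End ℂ (SemiInfComplex W W') :=
  (8 * η₁ * Real.pi * Complex.I : ℂ)⁻¹ • contourIntegral
    (normalProd (-1) (cField W W') (normalProd 1 (aMinus ρ ρ') (chiField W W')))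

/-- `L(z) = 𝓛(z) - (1/4η) :a(z)²:`. -/
def LDecoupled : VertexOperator ℂ (SemiInfComplex W W') :=
  decoupled η₁ (LField ρ) (aField ρ)

/-- `L̄(z) = 𝓛̄(z) - (1/4η̄) :ā(z)²:`. -/
def LbarDecoupled : VertexOperator ℂ (SemiInfComplex W W') :=
  decoupled η₂ (LbarField ρ') (abarField ρ')

end Operators

end W2BRST

end

-- Write $\alpha=a$, $\beta=\bar a$ and $r=1/(4\eta)$, so that $R$ is the residue of
-- $r\,c\,a^-\chi$. Since $\eta+\bar\eta=0$, the central terms of $a^-$ with itself cancel, so the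
-- modes of $c$, $a^-$, $\chi$ all commute or anticommute. Hence $R$ is locally nilpotent and
-- commutes with these three fields. Contracting one factor gives $[R,b]=-r\,a^-\chi$,
-- $[R,\psi]=r\,c\,a^-$ and, because $[a^+,a^-]$ has level $4\eta$, $[R,a^+]=\partial(c\chi)$. These
-- brackets again commute with $R$, so conjugation by $e^R$ adds exactly the first-order term
-- (`conj_eq_add`).
--
-- Substituted into the direct-sum current, the new terms under the residue are as follows.
-- $\psi\,\partial(c\chi)$ is $c\,\partial\psi\,\chi$ after integration by parts
-- (`residue_ψ_deriv`). $r\,c\,a^-a^+$ is $r\,c(:\alpha^2:-:\beta^2:)$ (`residue_ca_A`) and cancels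
-- the quadratic part of $L+\bar L$. $r\,c\,a^-\partial(c\chi)$ is $r\,c\,\partial c\,a^-\chi$
-- because $c(z)^2=0$ (`residue_ca_deriv`), and cancels the correction to $b$. What remains is the
-- semi-direct current. The normally ordered products are not associative or commutative in general;
-- the rearrangements rest on `normalProd_left_comm` and `residue_normalProd_comm`.
--
-- The decoupling is the Sugawara construction: $\frac1{4\eta}:a^2:$ acts on $a$ as $\mathcal L$
-- does, so $L$ commutes with $a$ and hence with $:a^2:$. Therefore $[L_n,L_m]=[L_n,\mathcal L_m]$,
-- and the central term of $[\mathcal L_m,:a^2:_n]$ (`IsW2.comm_L_sq`) lowers the charge by one.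

noncomputable section

namespace W2BRST

open HVertexOperator (coeff)

-- Calculus of normally ordered products, their residues and graded brackets

section Calculus

variable {V : Type*} [AddCommGroup V] [Module ℂ V]

theorem ext_coeff {A B : VertexOperator ℂ V} (h : ∀ k, coeff A k = coeff B k) : A = B :=
  HVertexOperator.coeff_inj (funext h)

theorem coeff_add (A B : VertexOperator ℂ V) (k : ℤ) :
    coeff (A + B) k = coeff A k + coeff B k := by
  rw [map_add, Pi.add_apply]

theorem coeff_sub (A B : VertexOperator ℂ V) (k : ℤ) :
    coeff (A - B) k = coeff A k - coeff B k := by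
  rw [map_sub, Pi.sub_apply]

theorem coeff_smul (r : ℂ) (A : VertexOperator ℂ V) (k : ℤ) :
    coeff (r • A) k = r • coeff A k := by
  rw [map_smul, Pi.smul_apply]

theorem coeff_zero (k : ℤ) : coeff (0 : VertexOperator ℂ V) k = 0 := by
  rw [map_zero, Pi.zero_apply]

theorem coeff_deriv (A : VertexOperator ℂ V) (k : ℤ) :
    coeff (deriv A) k = ((k : ℂ) + 1) • coeff A (k + 1) := rfl

theorem coeff_normalProd_apply (s : ℂ) (A B : VertexOperator ℂ V) (k : ℤ) (v : V) :
    coeff (normalProd s A B) k v = ∑ᶠ i, normalTerm s A B k i v := rfl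

theorem coeff_conj (R : Module.End ℂ V) (A : VertexOperator ℂ V) (k : ℤ) :
    coeff (conj R A) k = expOp R * coeff A k * expOp (-R) := rfl

theorem normalTerm_hasFiniteSupport (s : ℂ) (A B : VertexOperator ℂ V) (k : ℤ) (v : V) :
    Function.HasFiniteSupport fun i ↦ normalTerm s A B k i v :=
  normalTerm_finite s A B k v

theorem smul_normalTerm_hasFiniteSupport (r s : ℂ) (A B : VertexOperator ℂ V) (k : ℤ) (v : V) :
    Function.HasFiniteSupport fun i ↦ r • normalTerm s A B k i v :=
  (normalTerm_finite s A B k v).subset fun i hi h ↦ hi (by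
    change r • normalTerm s A B k i v = 0
    rw [show normalTerm s A B k i v = 0 from h, smul_zero])

theorem normalProd_add_left (s : ℂ) (A A' B : VertexOperator ℂ V) :
    normalProd s (A + A') B = normalProd s A B + normalProd s A' B := by
  refine ext_coeff fun k ↦ LinearMap.ext fun v ↦ ?_
  rw [coeff_add, LinearMap.add_apply]
  simp only [coeff_normalProd_apply]
  rw [← finsum_add_distrib (normalTerm_hasFiniteSupport ..) (normalTerm_hasFiniteSupport ..)]
  refine finsum_congr fun i ↦ ?_
  unfold normalTerm
  split_ifs <;> simp [coeff_add, -VertexOperator.coeff_eq_ncoeff]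

theorem normalProd_add_right (s : ℂ) (A B B' : VertexOperator ℂ V) :
    normalProd s A (B + B') = normalProd s A B + normalProd s A B' := by
  refine ext_coeff fun k ↦ LinearMap.ext fun v ↦ ?_
  rw [coeff_add, LinearMap.add_apply]
  simp only [coeff_normalProd_apply]
  rw [← finsum_add_distrib (normalTerm_hasFiniteSupport ..) (normalTerm_hasFiniteSupport ..)]
  refine finsum_congr fun i ↦ ?_
  unfold normalTerm
  split_ifs <;> simp [coeff_add, -VertexOperator.coeff_eq_ncoeff]

theorem normalProd_smul_left (s r : ℂ) (A B : VertexOperator ℂ V) :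
    normalProd s (r • A) B = r • normalProd s A B := by
  refine ext_coeff fun k ↦ LinearMap.ext fun v ↦ ?_
  rw [coeff_smul, LinearMap.smul_apply]
  simp only [coeff_normalProd_apply]
  rw [smul_finsum' r (normalTerm_hasFiniteSupport ..)]
  refine finsum_congr fun i ↦ ?_
  unfold normalTerm
  rw [coeff_smul]
  split_ifs
  · simp only [Module.End.mul_apply, LinearMap.smul_apply]
  · simp only [Module.End.mul_apply, LinearMap.smul_apply, map_smul]
    exact smul_comm _ _ _

theorem normalProd_smul_right (s r : ℂ) (A B : VertexOperator ℂ V) :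
    normalProd s A (r • B) = r • normalProd s A B := by
  refine ext_coeff fun k ↦ LinearMap.ext fun v ↦ ?_
  rw [coeff_smul, LinearMap.smul_apply]
  simp only [coeff_normalProd_apply]
  rw [smul_finsum' r (normalTerm_hasFiniteSupport ..)]
  refine finsum_congr fun i ↦ ?_
  unfold normalTerm
  rw [coeff_smul]
  split_ifs
  · simp only [Module.End.mul_apply, LinearMap.smul_apply, map_smul]
  · simp only [Module.End.mul_apply, LinearMap.smul_apply]
    exact smul_comm _ _ _

theorem normalProd_sub_left (s : ℂ) (A A' B : VertexOperator ℂ V) :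
    normalProd s (A - A') B = normalProd s A B - normalProd s A' B := by
  rw [eq_sub_iff_add_eq, ← normalProd_add_left, sub_add_cancel]

theorem normalProd_sub_right (s : ℂ) (A B B' : VertexOperator ℂ V) :
    normalProd s A (B - B') = normalProd s A B - normalProd s A B' := by
  rw [eq_sub_iff_add_eq, ← normalProd_add_right, sub_add_cancel]

theorem normalProd_zero_left (s : ℂ) (B : VertexOperator ℂ V) :
    normalProd s 0 B = 0 := by
  simpa using normalProd_sub_left s 0 0 B

theorem normalProd_zero_right (s : ℂ) (A : VertexOperator ℂ V) :
    normalProd s A 0 = 0 := by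
  simpa using normalProd_sub_right s A 0 0

/-- The derivative is a derivation of the normally ordered product. -/
theorem deriv_normalProd (s : ℂ) (A B : VertexOperator ℂ V) :
    deriv (normalProd s A B) = normalProd s (deriv A) B + normalProd s A (deriv B) := by
  refine ext_coeff fun k ↦ LinearMap.ext fun v ↦ ?_
  rw [coeff_add, LinearMap.add_apply, coeff_deriv, LinearMap.smul_apply]
  simp only [coeff_normalProd_apply]
  -- Shifting the index of the $\partial A$ sum by one makes all three summands involve the same
  -- pair of modes.
  rw [smul_finsum' _ (normalTerm_hasFiniteSupport ..),
    ← finsum_comp_equiv (Equiv.subRight (1 : ℤ)) (f := fun i ↦ normalTerm s (deriv A) B k i v),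
    ← finsum_add_distrib]
  · refine finsum_congr fun i ↦ ?_
    have e1 : k - (i - 1) = k + 1 - i := by ring
    have e2 : k - i + 1 = k + 1 - i := by ring
    have e3 : i - 1 + 1 = i := by ring
    simp only [Equiv.subRight_apply]
    unfold normalTerm
    simp only [coeff_deriv, e1, e2, e3]
    rcases lt_trichotomy i 0 with h | h | h
    · rw [if_neg (by omega), if_neg (by omega), if_neg (by omega)]
      simp only [LinearMap.smul_apply, Module.End.mul_apply, map_smul]
      push_cast
      module
    -- At $i=0$ the shifted term falls on the other side of the ordering split, but it carries the
    -- factor $i=0$.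
    · subst h
      rw [if_pos le_rfl, if_neg (by omega), if_pos le_rfl]
      simp only [LinearMap.smul_apply, Module.End.mul_apply, map_smul]
      push_cast
      module
    · rw [if_pos (by omega), if_pos (by omega), if_pos (by omega)]
      simp only [LinearMap.smul_apply, Module.End.mul_apply, map_smul]
      push_cast
      module
  · exact (normalTerm_finite s (deriv A) B k v).preimage (Equiv.injective _).injOn
  · exact normalTerm_hasFiniteSupport ..

theorem coeff_deriv_neg_one (A : VertexOperator ℂ V) : coeff (deriv A) (-1) = 0 := by
  rw [coeff_deriv]
  simp [-VertexOperator.coeff_eq_ncoeff]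

/-- Integration by parts. -/
theorem residue_normalProd_deriv (s : ℂ) (A B : VertexOperator ℂ V) :
    coeff (normalProd s A (deriv B)) (-1) = -coeff (normalProd s (deriv A) B) (-1) := by
  rw [eq_neg_iff_add_eq_zero, add_comm, ← coeff_add, ← deriv_normalProd, coeff_deriv_neg_one]

/-- No commutation of the fields is needed: in degree $-1$ the substitution $i\mapsto -1-i$
interchanges $i\ge0$ and $i<0$, hence the two halves of the normal ordering. -/
theorem residue_normalProd_comm {s : ℂ} (hs : s * s = 1) (A B : VertexOperator ℂ V) :
    coeff (normalProd s A B) (-1) = s • coeff (normalProd s B A) (-1) := by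
  refine LinearMap.ext fun v ↦ ?_
  rw [LinearMap.smul_apply]
  simp only [coeff_normalProd_apply]
  rw [smul_finsum' _ (normalTerm_hasFiniteSupport ..),
    ← finsum_comp_equiv (Equiv.subLeft (-1 : ℤ)) (f := fun i ↦ normalTerm s A B (-1) i v)]
  refine finsum_congr fun i ↦ ?_
  simp only [Equiv.subLeft_apply]
  unfold normalTerm
  rw [sub_sub_cancel]
  by_cases h : 0 ≤ i
  · rw [if_neg (by omega), if_pos h]; rfl
  · rw [if_pos (by omega), if_neg h, ← LinearMap.smul_apply, smul_smul, hs, one_smul]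

/-! ### Graded brackets -/

/-- The operator `X` satisfies `X A(z) - ε A(z) X = A'(z)`. -/
def HasBracket (X : Module.End ℂ V) (ε : ℂ) (A A' : VertexOperator ℂ V) : Prop :=
  ∀ k, X * coeff A k = coeff A' k + ε • (coeff A k * X)

/-- The graded Leibniz rule. An odd $X$ changes the parity of the factor it hits, which is why the
reordering sign $s$ is replaced by $s\varepsilon'$ or $s\varepsilon$. No contraction appears, since
$X$ acts on each summand separately. -/
theorem HasBracket.normalProd {X : Module.End ℂ V} {ε ε' : ℂ} {A A' B B' : VertexOperator ℂ V}
    (hA : HasBracket X ε A A') (hB : HasBracket X ε' B B') (hε : ε * ε = 1) (s : ℂ) :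
    HasBracket X (ε * ε') (normalProd s A B)
      (normalProd (s * ε') A' B + ε • normalProd (s * ε) A B') := by
  intro k
  refine LinearMap.ext fun v ↦ ?_
  have hA' : ∀ k v, X (coeff A k v) = coeff A' k v + ε • coeff A k (X v) :=
    fun k v ↦ LinearMap.congr_fun (hA k) v
  have hB' : ∀ k v, X (coeff B k v) = coeff B' k v + ε' • coeff B k (X v) :=
    fun k v ↦ LinearMap.congr_fun (hB k) v
  rw [coeff_add, coeff_smul]
  simp only [LinearMap.add_apply, LinearMap.smul_apply, Module.End.mul_apply,
    coeff_normalProd_apply]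
  rw [← LinearMap.toAddMonoidHom_coe, AddMonoidHom.map_finsum _ (normalTerm_hasFiniteSupport ..),
    smul_finsum' _ (normalTerm_hasFiniteSupport ..), smul_finsum' _ (normalTerm_hasFiniteSupport ..),
    ← finsum_add_distrib (normalTerm_hasFiniteSupport ..) (smul_normalTerm_hasFiniteSupport ..),
    ← finsum_add_distrib _ (smul_normalTerm_hasFiniteSupport ..)]
  · refine finsum_congr fun i ↦ ?_
    unfold normalTerm
    rw [LinearMap.toAddMonoidHom_coe]
    split_ifs
    · simp only [Module.End.mul_apply, hA', hB', map_add, map_smul]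
      module
    · simp only [Module.End.mul_apply, LinearMap.smul_apply, hA', hB', map_add, map_smul]
      have h1 : ε * (s * ε) = s := by rw [mul_left_comm, hε, mul_one]
      rw [smul_smul ε (s * ε), h1]
      module
  · refine ((normalTerm_finite (s * ε') A' B k v).union
      (smul_normalTerm_hasFiniteSupport ε (s * ε) A B' k v)).subset ?_
    exact Function.support_add _ _

theorem HasBracket.deriv {X : Module.End ℂ V} {ε : ℂ} {A A' : VertexOperator ℂ V}
    (hA : HasBracket X ε A A') : HasBracket X ε (deriv A) (deriv A') := by
  intro k
  rw [coeff_deriv, coeff_deriv, mul_smul_comm, hA, smul_add, smul_mul_assoc, smul_comm ε]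

theorem HasBracket.add {X : Module.End ℂ V} {ε : ℂ} {A A' B B' : VertexOperator ℂ V}
    (hA : HasBracket X ε A A') (hB : HasBracket X ε B B') :
    HasBracket X ε (A + B) (A' + B') := by
  intro k
  rw [coeff_add, coeff_add, mul_add, hA, hB, add_mul, smul_add]
  abel

theorem HasBracket.sub {X : Module.End ℂ V} {ε : ℂ} {A A' B B' : VertexOperator ℂ V}
    (hA : HasBracket X ε A A') (hB : HasBracket X ε B B') :
    HasBracket X ε (A - B) (A' - B') := by
  intro k
  rw [coeff_sub, coeff_sub, mul_sub, hA, hB, sub_mul, smul_sub]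
  abel

theorem HasBracket.smul {X : Module.End ℂ V} {ε : ℂ} {A A' : VertexOperator ℂ V}
    (hA : HasBracket X ε A A') (r : ℂ) : HasBracket X ε (r • A) (r • A') := by
  intro k
  rw [coeff_smul, coeff_smul, mul_smul_comm, hA, smul_add, smul_mul_assoc, smul_comm ε]

/-- The fields `A` and `B` satisfy `A(z) B(w) = s B(w) A(z)`. -/
def GradedComm (s : ℂ) (A B : VertexOperator ℂ V) : Prop :=
  ∀ i j, coeff A i * coeff B j = s • (coeff B j * coeff A i)

theorem GradedComm.hasBracket {s : ℂ} {A B : VertexOperator ℂ V} (h : GradedComm s A B) (i : ℤ) :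
    HasBracket (coeff A i) s B 0 := fun j ↦ by rw [coeff_zero, zero_add, h]

theorem gradedComm_of_hasBracket {s : ℂ} {A B : VertexOperator ℂ V}
    (h : ∀ i, HasBracket (coeff A i) s B 0) : GradedComm s A B := fun i j ↦ by
  rw [h i j, coeff_zero, zero_add]

theorem GradedComm.symm {s : ℂ} {A B : VertexOperator ℂ V} (h : GradedComm s A B)
    (hs : s * s = 1) : GradedComm s B A := fun i j ↦ by
  rw [h j i, smul_smul, hs, one_smul]

theorem HasBracket.normalProd_zero {X : Module.End ℂ V} {ε ε' : ℂ} {A B : VertexOperator ℂ V}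
    (hA : HasBracket X ε A 0) (hB : HasBracket X ε' B 0) (hε : ε * ε = 1) (s : ℂ) :
    HasBracket X (ε * ε') (W2BRST.normalProd s A B) 0 := by
  simpa only [normalProd_zero_left, normalProd_zero_right, smul_zero, add_zero]
    using hA.normalProd hB hε s

theorem GradedComm.normalProd {s t : ℂ} {A B C : VertexOperator ℂ V} (hB : GradedComm s A B)
    (hC : GradedComm t A C) (hs : s * s = 1) (u : ℂ) :
    GradedComm (s * t) A (normalProd u B C) :=
  gradedComm_of_hasBracket fun i ↦ (hB.hasBracket i).normalProd_zero (hC.hasBracket i) hs u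

theorem deriv_zero : deriv (0 : VertexOperator ℂ V) = 0 :=
  ext_coeff fun k ↦ by rw [coeff_deriv, coeff_zero, coeff_zero, smul_zero]

theorem GradedComm.deriv {s : ℂ} {A B : VertexOperator ℂ V} (h : GradedComm s A B) :
    GradedComm s A (deriv B) :=
  gradedComm_of_hasBracket fun i ↦ by simpa only [deriv_zero] using (h.hasBracket i).deriv

theorem GradedComm.add {s : ℂ} {A B C : VertexOperator ℂ V} (hB : GradedComm s A B)
    (hC : GradedComm s A C) : GradedComm s A (B + C) :=
  gradedComm_of_hasBracket fun i ↦ by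
    simpa only [add_zero] using (hB.hasBracket i).add (hC.hasBracket i)

theorem GradedComm.sub {s : ℂ} {A B C : VertexOperator ℂ V} (hB : GradedComm s A B)
    (hC : GradedComm s A C) : GradedComm s A (B - C) :=
  gradedComm_of_hasBracket fun i ↦ by
    simpa only [sub_zero] using (hB.hasBracket i).sub (hC.hasBracket i)

theorem normalTerm_of_gradedComm {s : ℂ} {A B : VertexOperator ℂ V} (h : GradedComm s A B)
    (k i : ℤ) : normalTerm s A B k i = coeff A i * coeff B (k - i) := by
  unfold normalTerm
  split_ifs
  · rfl
  · rw [h]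

theorem normalProd_comm {s : ℂ} {A B : VertexOperator ℂ V} (h : GradedComm s A B)
    (hs : s * s = 1) : normalProd s A B = s • normalProd s B A := by
  refine ext_coeff fun k ↦ LinearMap.ext fun v ↦ ?_
  rw [coeff_smul, LinearMap.smul_apply]
  simp only [coeff_normalProd_apply]
  rw [smul_finsum' _ (normalTerm_hasFiniteSupport ..),
    ← finsum_comp_equiv (Equiv.subLeft k) (f := fun i ↦ normalTerm s A B k i v)]
  refine finsum_congr fun i ↦ ?_
  simp only [Equiv.subLeft_apply]
  rw [normalTerm_of_gradedComm h, normalTerm_of_gradedComm (h.symm hs), sub_sub_cancel, h]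
  rfl

/-- The summands of the nested product `:A:BC::`. -/
def nestedTerm (t u : ℂ) (A B C : VertexOperator ℂ V) (k i j : ℤ) : Module.End ℂ V :=
  if 0 ≤ i then coeff A i * normalTerm u B C (k - i) j
  else t • (normalTerm u B C (k - i) j * coeff A i)

theorem exists_coeff_eq_zero_of_finite (A : VertexOperator ℂ V) {S : Set V} (hS : S.Finite) :
    ∃ N : ℤ, ∀ v ∈ S, ∀ k < N, coeff A k v = 0 := by
  induction S, hS using Set.Finite.induction_on with
  | empty => exact ⟨0, fun v hv ↦ hv.elim⟩
  | @insert a S _ _ ih =>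
    obtain ⟨N, hN⟩ := ih
    obtain ⟨N', hN'⟩ := coeff_lower_bound A a
    refine ⟨min N N', fun v hv k hk ↦ ?_⟩
    rcases hv with rfl | hv
    · exact hN' k (by omega)
    · exact hN v hv k (by omega)

/-- Joint finiteness in both indices, which permits writing the nested product as one double sum and
exchanging the order of summation. -/
theorem nestedTerm_finite (t u : ℂ) (A B C : VertexOperator ℂ V) (k : ℤ) (v : V) :
    Function.HasFiniteSupport fun p : ℤ × ℤ ↦ nestedTerm t u A B C k p.1 p.2 v := by
  obtain ⟨NA, hA⟩ := coeff_lower_bound A v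
  obtain ⟨NB, hB⟩ := coeff_lower_bound B v
  obtain ⟨NC, hC⟩ := coeff_lower_bound C v
  -- For $j<0$ only finitely many vectors $B^{(j)}v$ are nonzero, so one bound $M$ for $C$ serves
  -- them all.
  obtain ⟨M, hM⟩ := exists_coeff_eq_zero_of_finite C
    ((Set.finite_Icc NB 0).image fun j ↦ coeff B j v)
  have hneg : (⋃ i ∈ Set.Ico NA 0, (fun j ↦ (i, j)) '' Function.support
      fun j ↦ normalTerm u B C (k - i) j (coeff A i v)).Finite :=
    (Set.finite_Ico _ _).biUnion fun i _ ↦ (normalTerm_finite u B C (k - i) _).image _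
  refine (((Set.finite_Icc (0 : ℤ) (k - NC + k - M - NB)).prod
    (Set.finite_Icc NB (k - NC))).union (((Set.finite_Icc (0 : ℤ) (k - NC)).prod
    (Set.finite_Icc 0 (k - NC))).union (((Set.finite_Icc (0 : ℤ) (k - M - NB)).prod
    (Set.finite_Icc NB 0)).union hneg))).subset ?_
  rintro ⟨i, j⟩ hij
  have hij' : nestedTerm t u A B C k i j v ≠ 0 := hij
  unfold nestedTerm at hij'
  split_ifs at hij' with hi
  · have h : normalTerm u B C (k - i) j v ≠ 0 := fun h ↦ hij' (by
      rw [Module.End.mul_apply, h, map_zero])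
    unfold normalTerm at h
    split_ifs at h with hj
    · right; left
      have : ¬ (k - i - j < NC) := fun hlt ↦ h (by
        rw [Module.End.mul_apply, hC _ hlt, map_zero])
      simp only [Set.mem_prod, Set.mem_Icc]
      omega
    · right; right; left
      have h1 : ¬ j < NB := fun hlt ↦ h (by
        rw [LinearMap.smul_apply, Module.End.mul_apply, hB _ hlt, map_zero, smul_zero])
      have h2 : ¬ (k - i - j < M) := fun hlt ↦ h (by
        rw [LinearMap.smul_apply, Module.End.mul_apply,
          hM _ ⟨j, ⟨by omega, by omega⟩, rfl⟩ _ hlt, smul_zero])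
      simp only [Set.mem_prod, Set.mem_Icc]
      omega
  · right; right; right
    have h1 : ¬ i < NA := fun hlt ↦ hij' (by
      rw [LinearMap.smul_apply, Module.End.mul_apply, hA _ hlt, map_zero, smul_zero])
    have h2 : normalTerm u B C (k - i) j (coeff A i v) ≠ 0 := fun h ↦ hij' (by
      rw [LinearMap.smul_apply, Module.End.mul_apply, h, smul_zero])
    simp only [Set.mem_iUnion]
    exact ⟨i, ⟨by omega, by omega⟩, j, h2, rfl⟩

theorem coeff_nested (t u : ℂ) (A B C : VertexOperator ℂ V) (k : ℤ) (v : V) :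
    coeff (normalProd t A (normalProd u B C)) k v =
      ∑ᶠ p : ℤ × ℤ, nestedTerm t u A B C k p.1 p.2 v := by
  rw [finsum_curry _ (nestedTerm_finite t u A B C k v), coeff_normalProd_apply]
  refine finsum_congr fun i ↦ ?_
  unfold normalTerm nestedTerm
  split_ifs with hi
  · rw [Module.End.mul_apply, coeff_normalProd_apply, ← LinearMap.toAddMonoidHom_coe,
      AddMonoidHom.map_finsum _ (normalTerm_hasFiniteSupport ..)]
    rfl
  · rw [LinearMap.smul_apply, Module.End.mul_apply, coeff_normalProd_apply,
      smul_finsum' _ (normalTerm_hasFiniteSupport ..)]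
    rfl

/-- Left multiplications by (anti)commuting fields (anti)commute. -/
theorem normalProd_left_comm {s : ℂ} {A B : VertexOperator ℂ V} (h : GradedComm s A B)
    (hs : s * s = 1) (t u : ℂ) (C : VertexOperator ℂ V) :
    normalProd t A (normalProd u B C) =
      s • normalProd (s * u) B (normalProd (s * t) A C) := by
  refine ext_coeff fun k ↦ LinearMap.ext fun v ↦ ?_
  rw [coeff_smul, LinearMap.smul_apply, coeff_nested, coeff_nested,
    smul_finsum' _ (nestedTerm_finite ..), ← finsum_comp_equiv (Equiv.prodComm ℤ ℤ)]
  refine finsum_congr fun p ↦ ?_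
  obtain ⟨j, i⟩ := p
  -- In each nested product every mode of $A$ or $B$ stands left or right of $C$ according to the
  -- sign of its own degree, so the summands differ only by exchanges of an $A$ mode with a $B$
  -- mode.
  have h' : ∀ v, coeff A i (coeff B j v) = s • coeff B j (coeff A i v) :=
    fun v ↦ LinearMap.congr_fun (h i j) v
  have e : k - i - j = k - j - i := by ring
  simp only [Equiv.prodComm_apply, Prod.swap_prod_mk]
  unfold nestedTerm normalTerm
  rw [e]
  split_ifs <;>
    simp only [Module.End.mul_apply, LinearMap.smul_apply, map_smul, smul_smul, h']
  · rw [← mul_assoc, hs, one_mul]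
  · rw [← mul_assoc, hs, one_mul]
  · rw [show s * (s * u * (s * t * s)) = s * s * (s * s) * (t * u) by ring, hs, mul_one, one_mul]

end Calculus

-- Multiplication by powers of $z$, the form taken by central brackets

section Shift

variable {V : Type*} [AddCommGroup V] [Module ℂ V]

variable (V) in
/-- The field `zᵖ`. -/
def monomial (p : ℤ) : VertexOperator ℂ V :=
  VertexOperator.of_coeff (fun k ↦ if k = p then 1 else 0) fun v ↦ by
    refine ⟨p, fun k hk ↦ ?_⟩
    by_contra hlt
    exact hk (by simp only [if_neg (show ¬ k = p by omega), LinearMap.zero_apply])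

/-- The field `zᵖ A(z)`. -/
def shift (p : ℤ) (A : VertexOperator ℂ V) : VertexOperator ℂ V :=
  VertexOperator.of_coeff (fun k ↦ coeff A (k - p)) fun v ↦ by
    obtain ⟨N, hN⟩ := coeff_lower_bound A v
    refine ⟨N + p, fun k hk ↦ ?_⟩
    by_contra hlt
    exact hk (hN _ (by omega))

theorem coeff_monomial (p k : ℤ) : coeff (monomial V p) k = if k = p then 1 else 0 := rfl

theorem coeff_shift (p : ℤ) (A : VertexOperator ℂ V) (k : ℤ) :
    coeff (shift p A) k = coeff A (k - p) := rfl

theorem normalProd_shift_right (s : ℂ) (p : ℤ) (A B : VertexOperator ℂ V) :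
    normalProd s A (shift p B) = shift p (normalProd s A B) := by
  refine ext_coeff fun k ↦ LinearMap.ext fun v ↦ ?_
  rw [coeff_shift]
  simp only [coeff_normalProd_apply]
  refine finsum_congr fun i ↦ ?_
  unfold normalTerm
  rw [coeff_shift, sub_right_comm]

theorem normalProd_monomial_left (p : ℤ) (B : VertexOperator ℂ V) :
    normalProd 1 (monomial V p) B = shift p B := by
  refine ext_coeff fun k ↦ LinearMap.ext fun v ↦ ?_
  rw [coeff_normalProd_apply, finsum_eq_single _ p]
  · unfold normalTerm
    rw [coeff_monomial, if_pos rfl, mul_one, one_mul, one_smul, ite_self, coeff_shift]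
  · intro i hi
    unfold normalTerm
    rw [coeff_monomial, if_neg hi, mul_zero, zero_mul, smul_zero, ite_self, LinearMap.zero_apply]

theorem normalProd_monomial_right (p : ℤ) (A : VertexOperator ℂ V) :
    normalProd 1 A (monomial V p) = shift p A := by
  refine ext_coeff fun k ↦ LinearMap.ext fun v ↦ ?_
  rw [coeff_normalProd_apply, finsum_eq_single _ (k - p)]
  · unfold normalTerm
    rw [coeff_monomial, if_pos (show k - (k - p) = p by ring), mul_one, one_mul, one_smul, ite_self,
      coeff_shift]
  · intro i hi
    unfold normalTerm
    rw [coeff_monomial, if_neg (show ¬ k - i = p by omega), mul_zero, zero_mul, smul_zero, ite_self,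
      LinearMap.zero_apply]

end Shift

-- Exponentials of locally nilpotent operators

section Exponential

variable {V : Type*} [AddCommGroup V] [Module ℂ V]

theorem expOp_apply {R : Module.End ℂ V} (hR : IsLocallyNilpotent R) {v : V} {N : ℕ}
    (hN : (R ^ N) v = 0) :
    expOp R v = ∑ n ∈ Finset.range N, ((n.factorial : ℂ)⁻¹) • (R ^ n) v := by
  unfold expOp
  rw [dif_pos hR]
  refine finsum_eq_sum_of_support_subset _ fun n hn ↦ ?_
  rw [Finset.coe_range, Set.mem_Iio]
  by_contra h
  refine hn ?_
  change ((n.factorial : ℂ)⁻¹) • (R ^ n) v = 0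
  rw [show n = (n - N) + N by omega, pow_add, Module.End.mul_apply, hN, map_zero, smul_zero]

theorem IsLocallyNilpotent.smul {R : Module.End ℂ V} (hR : IsLocallyNilpotent R) (r : ℂ) :
    IsLocallyNilpotent (r • R) := fun v ↦ by
  obtain ⟨n, hn⟩ := hR v
  exact ⟨n, by rw [smul_pow, LinearMap.smul_apply, hn, smul_zero]⟩

theorem pow_apply_eq_zero_of_le {R : Module.End ℂ V} {v : V} {m n : ℕ} (h : (R ^ m) v = 0)
    (hmn : m ≤ n) : (R ^ n) v = 0 := by
  rw [show n = (n - m) + m by omega, pow_add, Module.End.mul_apply, h, map_zero]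

open Polynomial in
theorem expOp_mul_expOp_neg {R : Module.End ℂ V} (hR : IsLocallyNilpotent R) :
    expOp R * expOp (-R) = 1 := by
  refine LinearMap.ext fun v ↦ ?_
  obtain ⟨N, hN⟩ := hR v
  -- On $\ker R^N$ the exponential is a truncated power series evaluated at $R$, so the claim
  -- becomes $e^Xe^{-X}\equiv1$ modulo $X^N$.
  have key : ∀ (r : ℂ) (u : V), (R ^ N) u = 0 → expOp (r • R) u =
      aeval R (PowerSeries.trunc N (PowerSeries.rescale r (PowerSeries.exp ℂ))) u := by
    intro r u hu
    have hu' : ((r • R) ^ N) u = 0 := by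
      rw [_root_.smul_pow, LinearMap.smul_apply, hu, smul_zero]
    rw [expOp_apply (hR.smul r) hu', PowerSeries.trunc_apply, map_sum, LinearMap.sum_apply,
      Nat.Ico_zero_eq_range]
    refine Finset.sum_congr rfl fun n _ ↦ ?_
    rw [aeval_monomial, PowerSeries.coeff_rescale, PowerSeries.coeff_exp,
      Module.algebraMap_end_eq_smul_id, _root_.smul_pow]
    simp [smul_smul, mul_comm]
  have h1 : (R ^ N) (expOp (-R) v) = 0 := by
    have := key (-1) v hN
    rw [neg_smul, one_smul] at this
    have hX : R ^ N = aeval R (X ^ N : ℂ[X]) := by rw [map_pow, aeval_X]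
    rw [this, ← Module.End.mul_apply, hX, ← map_mul, mul_comm, map_mul, Module.End.mul_apply, ← hX,
      hN, map_zero]
  have e1 := key 1 _ h1
  have e2 := key (-1) v hN
  rw [one_smul] at e1
  rw [neg_smul, one_smul] at e2
  rw [Module.End.mul_apply, e1, e2, ← Module.End.mul_apply, ← map_mul]
  set p := PowerSeries.trunc N (PowerSeries.rescale (1 : ℂ) (PowerSeries.exp ℂ))
  set q := PowerSeries.trunc N (PowerSeries.rescale (-1 : ℂ) (PowerSeries.exp ℂ))
  have hpq : X ^ N ∣ p * q - 1 := by
    rw [X_pow_dvd_iff]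
    intro d hd
    have h2 := PowerSeries.trunc_trunc_mul_trunc (n := N)
      (PowerSeries.rescale (1 : ℂ) (PowerSeries.exp ℂ))
      (PowerSeries.rescale (-1 : ℂ) (PowerSeries.exp ℂ))
    have h3 : PowerSeries.rescale (1 : ℂ) (PowerSeries.exp ℂ) *
        PowerSeries.rescale (-1 : ℂ) (PowerSeries.exp ℂ) = 1 := by
      rw [PowerSeries.rescale_one, RingHom.id_apply]
      exact PowerSeries.exp_mul_exp_neg_eq_one
    rw [h3] at h2
    have h4 := congrArg (fun f ↦ Polynomial.coeff f d) h2
    simp only [PowerSeries.coeff_trunc, if_pos hd] at h4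
    rw [← Polynomial.coe_mul, Polynomial.coeff_coe, PowerSeries.coeff_one] at h4
    rw [Polynomial.coeff_sub, h4, Polynomial.coeff_one, sub_self]
  obtain ⟨r, hr⟩ := hpq
  rw [sub_eq_iff_eq_add.mp hr, mul_comm, map_add, map_mul, map_pow, aeval_X, map_one,
    LinearMap.add_apply, Module.End.mul_apply, hN, map_zero, zero_add]

theorem pow_succ_mul_of_commutator {R X D : Module.End ℂ V} (h : R * X = X * R + D)
    (hD : R * D = D * R) (n : ℕ) :
    R ^ (n + 1) * X = X * R ^ (n + 1) + ((n : ℂ) + 1) • (D * R ^ n) := by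
  induction n with
  | zero => simpa using h
  | succ n ih =>
    rw [pow_succ', mul_assoc, ih, mul_add, mul_smul_comm, ← mul_assoc, ← mul_assoc, h, hD, add_mul,
      mul_assoc, mul_assoc D, ← pow_succ', ← pow_succ']
    push_cast
    module

/-- When $D=[R,X]$ commutes with $R$, the $n+1$ equal terms of $[R^{n+1},X]=(n+1)DR^n$ turn
$1/(n+1)!$ into $1/n!$ and so reassemble to $De^R$. -/
theorem expOp_mul_of_commutator {R X D : Module.End ℂ V} (hR : IsLocallyNilpotent R)
    (h : R * X = X * R + D) (hD : R * D = D * R) :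
    expOp R * X = (X + D) * expOp R := by
  refine LinearMap.ext fun v ↦ ?_
  obtain ⟨N₁, h₁⟩ := hR v
  obtain ⟨N₂, h₂⟩ := hR (X v)
  set N := max N₁ N₂
  have hv : (R ^ N) v = 0 := pow_apply_eq_zero_of_le h₁ (le_max_left _ _)
  have hv' : (R ^ (N + 1)) v = 0 := pow_apply_eq_zero_of_le hv (Nat.le_succ _)
  have hX : (R ^ (N + 1)) (X v) = 0 :=
    pow_apply_eq_zero_of_le h₂ ((le_max_right _ _).trans (Nat.le_succ _))
  -- The sums for $e^RXv$ and $Xe^Rv$ run to $N+1$ and that for $De^Rv$ to $N$, because $R^{n+1}$ is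
  -- matched with $DR^n$.
  rw [Module.End.mul_apply, Module.End.mul_apply, LinearMap.add_apply, expOp_apply hR hX]
  nth_rw 1 [expOp_apply hR hv']
  rw [expOp_apply hR hv, Finset.sum_range_succ', Finset.sum_range_succ', map_add, map_sum, map_sum,
    add_right_comm, ← Finset.sum_add_distrib]
  congr 1
  · refine Finset.sum_congr rfl fun n _ ↦ ?_
    have := LinearMap.congr_fun (pow_succ_mul_of_commutator h hD n) v
    simp only [Module.End.mul_apply, LinearMap.add_apply, LinearMap.smul_apply] at this
    rw [this, smul_add, map_smul, map_smul, smul_smul]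
    congr 2
    have h1 : ((n : ℂ) + 1) ≠ 0 := by exact_mod_cast Nat.succ_ne_zero n
    have h2 : (n.factorial : ℂ) ≠ 0 := by exact_mod_cast n.factorial_ne_zero
    rw [Nat.factorial_succ]
    push_cast
    field_simp
  · simp

theorem conj_eq_add {R : Module.End ℂ V} (hR : IsLocallyNilpotent R) {A D : VertexOperator ℂ V}
    (hA : HasBracket R 1 A D) (hD : HasBracket R 1 D 0) : conj R A = A + D := by
  refine ext_coeff fun k ↦ ?_
  have h1 := hA k
  have h2 := hD k
  rw [one_smul, add_comm] at h1
  rw [coeff_zero, one_smul, zero_add] at h2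
  rw [coeff_conj, expOp_mul_of_commutator hR h1 h2, mul_assoc, expOp_mul_expOp_neg hR, mul_one,
    coeff_add]

theorem conj_eq_self {R : Module.End ℂ V} (hR : IsLocallyNilpotent R) {A : VertexOperator ℂ V}
    (hA : HasBracket R 1 A 0) : conj R A = A := by
  rw [conj_eq_add hR hA fun k ↦ by simp [coeff_zero, -VertexOperator.coeff_eq_ncoeff], add_zero]

end Exponential

-- Local nilpotence of the cubic residue

section LocalNilpotence

variable {V : Type*} [AddCommGroup V] [Module ℂ V]

/-- The vectors annihilated by all coefficients of `A` of degree less than `N`. -/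
def lowVectors (N : ℤ) (A : VertexOperator ℂ V) : Submodule ℂ V :=
  ⨅ n : Set.Iio N, LinearMap.ker (coeff A n)

theorem mem_lowVectors {N : ℤ} {A : VertexOperator ℂ V} {v : V} :
    v ∈ lowVectors N A ↔ ∀ n < N, coeff A n v = 0 := by
  simp [lowVectors, Submodule.mem_iInf, -VertexOperator.coeff_eq_ncoeff]

theorem GradedComm.coeff_mem_lowVectors {s : ℂ} {A B : VertexOperator ℂ V} (h : GradedComm s A B)
    {N : ℤ} {v : V} (hv : v ∈ lowVectors N A) (k : ℤ) : coeff B k v ∈ lowVectors N A := by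
  rw [mem_lowVectors] at hv ⊢
  intro n hn
  have := LinearMap.congr_fun (h n k) v
  rw [LinearMap.smul_apply, Module.End.mul_apply, Module.End.mul_apply, hv n hn, map_zero,
    smul_zero] at this
  exact this

theorem coeff_normalProd_eq_sum {s : ℂ} {A B : VertexOperator ℂ V} (h : GradedComm s A B)
    {v : V} {N M k : ℤ} {S : Finset ℤ} (hA : v ∈ lowVectors N A)
    (hB : v ∈ lowVectors M B) (hS : Finset.Icc N (k - M) ⊆ S) :
    coeff (normalProd s A B) k v = ∑ i ∈ S, coeff A i (coeff B (k - i) v) := by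
  rw [mem_lowVectors] at hA hB
  rw [coeff_normalProd_apply]
  simp only [normalTerm_of_gradedComm h]
  refine finsum_eq_sum_of_support_subset _ fun i hi ↦ hS ?_
  rw [Finset.mem_Icc]
  have h1 : ¬ i < N := fun hlt ↦ hi (by
    change (coeff A i * coeff B (k - i)) v = 0
    rw [h, LinearMap.smul_apply, Module.End.mul_apply, hA i hlt, map_zero, smul_zero])
  have h2 : ¬ k - i < M := fun hlt ↦ hi (by
    change (coeff A i * coeff B (k - i)) v = 0
    rw [Module.End.mul_apply, hB _ hlt, map_zero])
  omega

theorem mul_self_eq_zero_of_gradedComm {c : VertexOperator ℂ V} (hcc : GradedComm (-1) c c)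
    (i : ℤ) : coeff c i * coeff c i = 0 := by
  have h := hcc i i
  rw [neg_smul, one_smul, eq_neg_iff_add_eq_zero, ← two_smul ℂ] at h
  exact (smul_eq_zero.mp h).resolve_left two_ne_zero

/-- A coefficient of `:c(z)a(z)χ(z):`, with `c`, `χ` fermionic, `a` bosonic and all of them
mutually (anti)commuting, is locally nilpotent: on the vectors annihilated by the modes of degree
less than `N` it is a finite sum of commuting operators of square zero. -/
theorem isLocallyNilpotent_coeff_normalProd {c a χ : VertexOperator ℂ V}
    (hcc : GradedComm (-1) c c) (hca : GradedComm 1 c a) (hcχ : GradedComm (-1) c χ)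
    (haa : GradedComm 1 a a) (haχ : GradedComm 1 a χ) (hχχ : GradedComm (-1) χ χ) (k : ℤ) :
    IsLocallyNilpotent (coeff (normalProd (-1) c (normalProd 1 a χ)) k) := by
  intro v
  have h11 : (1 : ℂ) * 1 = 1 := one_mul 1
  have hmm : (-1 : ℂ) * -1 = 1 := by norm_num
  have hac := hca.symm h11
  have hχc := hcχ.symm hmm
  have hχa := haχ.symm h11
  obtain ⟨N₁, h₁⟩ := coeff_lower_bound c v
  obtain ⟨N₂, h₂⟩ := coeff_lower_bound a v
  obtain ⟨N₃, h₃⟩ := coeff_lower_bound χ v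
  set N := min N₁ (min N₂ N₃)
  set U : Submodule ℂ V := lowVectors N c ⊓ (lowVectors N a ⊓ lowVectors N χ) with hU
  have hvU : v ∈ U := by
    refine ⟨mem_lowVectors.mpr fun n hn ↦ h₁ n (by omega),
      mem_lowVectors.mpr fun n hn ↦ h₂ n (by omega), mem_lowVectors.mpr fun n hn ↦ h₃ n (by omega)⟩
  have hcU : ∀ k, ∀ u ∈ U, coeff c k u ∈ U := fun k u hu ↦
    ⟨hcc.coeff_mem_lowVectors hu.1 k, hac.coeff_mem_lowVectors hu.2.1 k,
      hχc.coeff_mem_lowVectors hu.2.2 k⟩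
  have haU : ∀ k, ∀ u ∈ U, coeff a k u ∈ U := fun k u hu ↦
    ⟨hca.coeff_mem_lowVectors hu.1 k, haa.coeff_mem_lowVectors hu.2.1 k,
      hχa.coeff_mem_lowVectors hu.2.2 k⟩
  have hχU : ∀ k, ∀ u ∈ U, coeff χ k u ∈ U := fun k u hu ↦
    ⟨hcχ.coeff_mem_lowVectors hu.1 k, haχ.coeff_mem_lowVectors hu.2.1 k,
      hχχ.coeff_mem_lowVectors hu.2.2 k⟩
  set S := Finset.Icc N (k - N - N)
  set T : ℤ × ℤ → Module.End ℂ V :=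
    fun p ↦ coeff c p.1 * (coeff a p.2 * coeff χ (k - p.1 - p.2)) with hT
  set P : Module.End ℂ V := ∑ p ∈ S ×ˢ S, T p with hP
  have hPU : ∀ u ∈ U, P u ∈ U := fun u hu ↦ by
    rw [hP, LinearMap.sum_apply]
    exact Submodule.sum_mem _ fun p _ ↦ hcU _ _ (haU _ _ (hχU _ _ hu))
  have hFP : ∀ u ∈ U, coeff (normalProd (-1) c (normalProd 1 a χ)) k u = P u := by
    intro u hu
    have hX : u ∈ lowVectors (N + N) (normalProd 1 a χ) := by
      rw [mem_lowVectors]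
      intro n hn
      rw [coeff_normalProd_eq_sum haχ hu.2.1 hu.2.2 (S := ∅), Finset.sum_empty]
      rw [Finset.Icc_eq_empty (by omega)]
    have hcX : GradedComm (-1) c (normalProd 1 a χ) := by
      simpa using hca.normalProd hcχ h11 1
    -- One box $S\times S$ suffices: the outer index is at least $N$, so the inner one is at most
    -- $k-i-N\le k-2N$.
    rw [coeff_normalProd_eq_sum hcX hu.1 hX (S := S)
      (Finset.Icc_subset_Icc le_rfl (by omega)), hP, LinearMap.sum_apply, Finset.sum_product]
    refine Finset.sum_congr rfl fun i hi ↦ ?_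
    rw [Finset.mem_Icc] at hi
    rw [coeff_normalProd_eq_sum haχ hu.2.1 hu.2.2 (S := S)
      (Finset.Icc_subset_Icc le_rfl (by omega)), map_sum]
    rfl
  have hPnil : IsNilpotent P := by
    have hcT : ∀ i p, coeff c i * T p = T p * coeff c i := by
      intro i p
      have e1 := hcc i p.1
      have e2 := hca i p.2
      have e3 := hcχ i (k - p.1 - p.2)
      simp only [hT, one_smul, neg_smul] at e1 e2 e3 ⊢
      rw [← mul_assoc, e1, neg_mul, mul_assoc, ← mul_assoc (coeff c i), e2, mul_assoc, e3]
      simp only [mul_neg, neg_neg, mul_assoc]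
    have haT : ∀ i p, coeff a i * T p = T p * coeff a i := by
      intro i p
      have e1 := hac i p.1
      have e2 := haa i p.2
      have e3 := haχ i (k - p.1 - p.2)
      simp only [hT, one_smul] at e1 e2 e3 ⊢
      rw [← mul_assoc, e1, mul_assoc, ← mul_assoc (coeff a i), e2, mul_assoc, e3]
      simp only [mul_assoc]
    have hχT : ∀ i p, coeff χ i * T p = T p * coeff χ i := by
      intro i p
      have e1 := hχc i p.1
      have e2 := hχa i p.2
      have e3 := hχχ i (k - p.1 - p.2)
      simp only [hT, one_smul, neg_smul] at e1 e2 e3 ⊢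
      rw [← mul_assoc, e1, neg_mul, mul_assoc, ← mul_assoc (coeff χ i), e2, mul_assoc, e3]
      simp only [mul_neg, neg_neg, mul_assoc]
    -- Each $T_p$ has two fermionic factors, hence commutes with all modes of $c$, $a$ and $\chi$;
    -- its square contains the square of a mode of $c$, which is zero.
    refine Commute.isNilpotent_sum (fun p _ ↦ ⟨2, ?_⟩) fun p q _ _ ↦ ?_
    · rw [pow_two]
      conv_lhs => enter [1]; rw [hT]
      simp only
      rw [mul_assoc, mul_assoc, hχT, ← mul_assoc (coeff a _), haT, mul_assoc,
        ← mul_assoc, ← mul_assoc]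
      conv_lhs => enter [1, 1, 2]; rw [hT]
      simp only
      rw [← mul_assoc, mul_self_eq_zero_of_gradedComm hcc, zero_mul, zero_mul, zero_mul]
    · change T p * T q = T q * T p
      conv_lhs => enter [1]; rw [hT]
      conv_rhs => enter [2]; rw [hT]
      simp only
      rw [mul_assoc, mul_assoc, hχT, ← mul_assoc (coeff a _), haT, mul_assoc, ← mul_assoc, hcT,
        mul_assoc]
  obtain ⟨n, hn⟩ := hPnil
  refine ⟨n, ?_⟩
  have hpow : ∀ m : ℕ, ∀ u ∈ U,
      (coeff (normalProd (-1) c (normalProd 1 a χ)) k ^ m) u = (P ^ m) u := by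
    intro m
    induction m with
    | zero => intro u _; rfl
    | succ m ih =>
      intro u hu
      rw [pow_succ, pow_succ, Module.End.mul_apply, Module.End.mul_apply, hFP u hu,
        ih _ (hPU u hu)]
  rw [hpow n v hvU, hn, LinearMap.zero_apply]

end LocalNilpotence

-- Sugawara decoupling of the Heisenberg field

section Sugawara

variable {V : Type*} [AddCommGroup V] [Module ℂ V]

/-- The weight in the difference between the normal orderings split at `-m` and at `0`. -/
def orderingDefect (m i : ℤ) : ℂ :=
  ((i : ℂ) + m + 1) * (-(i : ℂ) - 1) *
    ((if -m ≤ i then 1 else 0) - (if 0 ≤ i then 1 else 0))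

theorem orderingDefect_finite (m : ℤ) : Function.HasFiniteSupport (orderingDefect m) := by
  refine (Set.finite_Ico (min (-m) 0) (max (-m) 0)).subset fun i hi ↦ ?_
  rw [Function.mem_support] at hi
  rw [Set.mem_Ico]
  by_contra h
  refine hi ?_
  unfold orderingDefect
  by_cases h0 : 0 ≤ i
  · rw [if_pos (by omega), if_pos h0, sub_self, mul_zero]
  · rw [if_neg (by omega), if_neg h0, sub_self, mul_zero]

theorem sum_range_mul_sub (a b : ℂ) (n : ℕ) :
    ∑ j ∈ Finset.range n, ((j : ℂ) + a) * (b - j) =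
      n * a * b + (b - a) * (n * (n - 1) / 2) - (n - 1) * n * (2 * n - 1) / 6 := by
  induction n with
  | zero => simp
  | succ n ih =>
    rw [Finset.sum_range_succ, ih]
    push_cast
    ring

/-- The source of the cubic central term. The two splits differ on $-m\le i<0$ or on $0\le i<-m$,
and the sum there is elementary. -/
theorem finsum_orderingDefect (m : ℤ) :
    ∑ᶠ i, orderingDefect m i = ((m : ℂ) ^ 3 - m) / 6 := by
  classical
  obtain ⟨n, rfl | rfl⟩ := m.eq_nat_or_neg
  · rw [finsum_eq_sum_of_support_subset (s := (Finset.range n).image fun j : ℕ ↦ -1 - (j : ℤ)),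
      Finset.sum_image fun a _ b _ h ↦ by simpa using h]
    · have : ∀ j ∈ Finset.range n,
          orderingDefect n (-1 - (j : ℤ)) = ((j : ℂ) + 0) * (n - j) := by
        intro j hj
        rw [Finset.mem_range] at hj
        unfold orderingDefect
        rw [if_pos (by omega), if_neg (by omega)]
        push_cast
        ring
      rw [Finset.sum_congr rfl this, sum_range_mul_sub]
      push_cast
      ring
    · intro i hi
      rw [Function.mem_support] at hi
      rw [Finset.coe_image, Set.mem_image]
      by_contra h
      refine hi ?_
      unfold orderingDefect
      by_cases h0 : 0 ≤ i
      · rw [if_pos (by omega), if_pos h0, sub_self, mul_zero]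
      · rw [if_neg fun h1 ↦ h ⟨(-1 - i).toNat, by simp; omega, by omega⟩, if_neg h0, sub_self,
          mul_zero]
  · rw [finsum_eq_sum_of_support_subset (s := (Finset.range n).image fun j : ℕ ↦ (j : ℤ)),
      Finset.sum_image fun a _ b _ h ↦ by simpa using h]
    · have : ∀ j ∈ Finset.range n,
          orderingDefect (-(n : ℤ)) (j : ℤ) = -(((j : ℂ) + 1) * ((n - 1 : ℂ) - j)) := by
        intro j hj
        rw [Finset.mem_range] at hj
        unfold orderingDefect
        rw [if_neg (by omega), if_pos (by omega)]
        push_cast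
        ring
      rw [Finset.sum_congr rfl this, Finset.sum_neg_distrib, sum_range_mul_sub]
      push_cast
      ring
    · intro i hi
      rw [Function.mem_support] at hi
      rw [Finset.coe_image, Set.mem_image]
      by_contra h
      refine hi ?_
      unfold orderingDefect
      by_cases h0 : 0 ≤ i
      · rw [if_pos (by by_contra h1; exact h ⟨i.toNat, by simp; omega, by omega⟩), if_pos h0,
          sub_self, mul_zero]
      · rw [if_neg (by omega), if_neg h0, sub_self, mul_zero]

theorem mode_def (h : ℤ) (A : VertexOperator ℂ V) (n : ℤ) : mode h A n = coeff A (-n - h) := rfl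

theorem coeff_eq_mode (h : ℤ) (A : VertexOperator ℂ V) (k : ℤ) :
    coeff A k = mode h A (-k - h) := by
  rw [mode_def, neg_sub, sub_neg_eq_add, add_sub_cancel_left]

/-- The modes of `T` and `a` satisfy the relations of `W₂`. -/
structure IsW2 (c η : ℂ) (T a : VertexOperator ℂ V) : Prop where
  comm_L_L : ∀ n m : ℤ, ⁅mode 2 T n, mode 2 T m⁆ = ((n : ℂ) - m) • mode 2 T (n + m) +
    (if n + m = 0 then c / 12 * ((n : ℂ) ^ 3 - n) else 0) • (1 : Module.End ℂ V)
  comm_a_a : ∀ n m : ℤ, ⁅mode 1 a n, mode 1 a m⁆ =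
    (if n + m = 0 then 2 * η * (n : ℂ) else 0) • (1 : Module.End ℂ V)
  comm_L_a : ∀ n m : ℤ, ⁅mode 2 T n, mode 1 a m⁆ = (-(m : ℂ)) • mode 1 a (n + m)

variable {c η : ℂ} {T a : VertexOperator ℂ V}

theorem IsW2.hasBracket_a (h : IsW2 c η T a) (m : ℤ) :
    HasBracket (mode 1 a m) 1 a ((2 * η * m : ℂ) • monomial V (m - 1)) := by
  intro k
  have := h.comm_a_a m (-k - 1)
  rw [← coeff_eq_mode, Ring.lie_def, sub_eq_iff_eq_add] at this
  rw [this, coeff_smul, coeff_monomial, one_smul]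
  congr 1
  by_cases hk : k = m - 1
  · rw [if_pos hk, if_pos (by omega)]
  · rw [if_neg hk, if_neg (by omega), zero_smul, smul_zero]

/-- The transformation law of a primary field of weight one. -/
theorem IsW2.hasBracket_L_a (h : IsW2 c η T a) (m : ℤ) :
    HasBracket (mode 2 T m) 1 a (shift (m + 1) (deriv a) + ((m : ℂ) + 1) • shift m a) := by
  intro k
  have := h.comm_L_a m (-k - 1)
  rw [← coeff_eq_mode, Ring.lie_def, sub_eq_iff_eq_add] at this
  rw [this, coeff_add, coeff_smul, coeff_shift, coeff_shift, coeff_deriv, one_smul, mode_def]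
  congr 1
  rw [show -(m + (-k - 1)) - 1 = k - m by ring, show k - (m + 1) + 1 = k - m by ring, ← add_smul]
  congr 1
  push_cast
  ring

/-- The commutator of a Virasoro mode with the modes of `:a(z)²:`. -/
theorem IsW2.comm_L_sq (h : IsW2 c η T a) (m n : ℤ) :
    ⁅mode 2 T m, mode 2 (normalProd 1 a a) n⁆ =
      ((m : ℂ) - n) • mode 2 (normalProd 1 a a) (m + n) +
        (if m + n = 0 then 2 * η * (((m : ℂ) ^ 3 - m) / 6) else 0) • (1 : Module.End ℂ V) := by
  set D := shift (m + 1) (deriv a) + ((m : ℂ) + 1) • shift m a with hD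
  have hDk : ∀ k, coeff D k = ((k : ℂ) + 1) • coeff a (k - m) := by
    intro k
    rw [hD, coeff_add, coeff_smul, coeff_shift, coeff_shift, coeff_deriv,
      show k - (m + 1) + 1 = k - m by ring, ← add_smul]
    congr 1
    push_cast
    ring
  have hb := (h.hasBracket_L_a m).normalProd (h.hasBracket_L_a m) (one_mul 1) 1 (-n - 2)
  rw [← hD] at hb
  rw [Ring.lie_def, sub_eq_iff_eq_add, mode_def 2 (normalProd 1 a a) n, hb]
  simp only [one_mul, one_smul]
  congr 1
  refine LinearMap.ext fun v ↦ ?_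
  rw [coeff_add, mode_def]
  simp only [LinearMap.add_apply, LinearMap.smul_apply, coeff_normalProd_apply,
    Module.End.one_apply]
  -- Shifting the first sum by $m$ aligns its modes with those of the other sums but moves its
  -- ordering split from $0$ to $-m$. Undoing this costs the commutators `hcomm`, whose total is
  -- `finsum_orderingDefect`.
  rw [smul_finsum' _ (normalTerm_hasFiniteSupport ..),
    ← finsum_comp_equiv (Equiv.addRight m) (f := fun i ↦ normalTerm 1 D a (-n - 2) i v)]
  have hcomm : ∀ i, coeff a i (coeff a (-(m + n) - 2 - i) v) =
      coeff a (-(m + n) - 2 - i) (coeff a i v) +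
        (if m + n = 0 then 2 * η * (-(i : ℂ) - 1) else 0) • v := by
    intro i
    have := LinearMap.congr_fun (h.comm_a_a (-i - 1) (m + n + 1 + i)) v
    rw [Ring.lie_def, mode_def, mode_def, show -(-i - 1) - 1 = i by ring,
      show -(m + n + 1 + i) - 1 = -(m + n) - 2 - i by ring,
      show -i - 1 + (m + n + 1 + i) = m + n by ring, LinearMap.sub_apply, sub_eq_iff_eq_add'] at this
    simp only [Module.End.mul_apply, LinearMap.smul_apply, Module.End.one_apply] at this
    rw [this]
    push_cast
    rfl
  have hdef : (if m + n = 0 then 2 * η * (((m : ℂ) ^ 3 - m) / 6) else 0) • v =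
      ∑ᶠ i, (if m + n = 0 then 2 * η * orderingDefect m i else 0) • v := by
    split_ifs
    · rw [← finsum_orderingDefect, ← smul_eq_mul, smul_finsum' _ (orderingDefect_finite m)]
      simp only [smul_eq_mul]
      rw [finsum_smul' ((orderingDefect_finite m).subset fun i hi h0 ↦ hi (by simp [h0]))]
    · simp
  rw [hdef, ← finsum_add_distrib _ (normalTerm_hasFiniteSupport ..),
    ← finsum_add_distrib (smul_normalTerm_hasFiniteSupport ..)]
  · refine finsum_congr fun i ↦ ?_
    simp only [Equiv.coe_addRight]
    have e1 : -n - 2 - (i + m) = -(m + n) - 2 - i := by ring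
    have e2 : -n - 2 - i - m = -(m + n) - 2 - i := by ring
    have e3 : i + m - m = i := by ring
    unfold normalTerm orderingDefect
    simp only [hDk, e1, e2, e3]
    have hc := hcomm i
    by_cases h0 : m + n = 0
    · rw [if_pos h0] at hc ⊢
      split_ifs <;>
      first
      | omega
      | (simp only [Module.End.mul_apply, LinearMap.smul_apply, map_smul, hc, smul_add]
         push_cast
         module)
    · rw [if_neg h0, zero_smul, add_zero] at hc
      rw [if_neg h0]
      split_ifs <;>
      first
      | omega
      | (simp only [Module.End.mul_apply, LinearMap.smul_apply, map_smul, hc]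
         push_cast
         module)
  · refine ((orderingDefect_finite m)).subset fun i hi h0 ↦ hi ?_
    simp only [h0, mul_zero, ite_self, zero_smul]
  · exact (normalTerm_finite 1 D a (-n - 2) v).preimage (Equiv.injective _).injOn

/-- The Sugawara decoupling of the Heisenberg field from the Virasoro field. -/
theorem IsW2.isVirasoroHeisenberg (h : IsW2 c η T a) (hη : η ≠ 0) :
    IsVirasoroHeisenberg (c - 1) η (decoupled η T a) a := by
  have hmode : ∀ n, mode 2 (decoupled η T a) n =
      mode 2 T n - (1 / (4 * η)) • mode 2 (normalProd 1 a a) n := by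
    intro n
    rw [mode_def, decoupled, coeff_sub, coeff_smul]
    rfl
  have hLa : ∀ n m : ℤ, ⁅mode 2 (decoupled η T a) n, mode 1 a m⁆ = 0 := by
    intro n m
    have h1 := h.comm_L_a n m
    -- Both factors contribute $2\eta m\,a_{n+m}$; the total $4\eta m\,a_{n+m}$ fixes the
    -- normalization $1/(4\eta)$.
    have h2 := (h.hasBracket_a m).normalProd (h.hasBracket_a m) (one_mul 1) 1 (-n - 2)
    rw [coeff_add, coeff_smul, normalProd_smul_left, normalProd_smul_right] at h2
    simp only [one_mul, one_smul, normalProd_monomial_left, normalProd_monomial_right, coeff_smul,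
      coeff_shift] at h2
    rw [show -n - 2 - (m - 1) = -(n + m) - 1 by ring, ← mode_def, ← mode_def] at h2
    rw [Ring.lie_def] at h1 ⊢
    rw [hmode, sub_mul, mul_sub, smul_mul_assoc, mul_smul_comm, h2, sub_sub_sub_comm, h1, smul_add,
      sub_add_cancel_right]
    match_scalars
    field_simp
    ring
  refine ⟨fun n m ↦ ?_, h.comm_a_a, hLa⟩
  have hLS : ⁅mode 2 (decoupled η T a) n, mode 2 (normalProd 1 a a) m⁆ = 0 := by
    have hb : HasBracket (mode 2 (decoupled η T a) n) 1 a 0 := by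
      intro k
      have := hLa n (-k - 1)
      rw [← coeff_eq_mode, Ring.lie_def, sub_eq_zero] at this
      rw [this, coeff_zero, one_smul, zero_add]
    have := hb.normalProd_zero hb (one_mul 1) 1 (-m - 2)
    rw [coeff_zero, zero_add, one_mul, one_smul] at this
    rw [Ring.lie_def, mode_def 2 (normalProd 1 a a), this, sub_self]
  have hsub : ∀ (x y z : Module.End ℂ V) (r : ℂ), ⁅x, y - r • z⁆ = ⁅x, y⁆ - r • ⁅x, z⁆ := by
    intro x y z r
    simp only [Ring.lie_def, mul_sub, sub_mul, mul_smul_comm, smul_mul_assoc, smul_sub]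
    abel
  have hsub' : ∀ (x y z : Module.End ℂ V) (r : ℂ), ⁅y - r • z, x⁆ = ⁅y, x⁆ + r • ⁅x, z⁆ := by
    intro x y z r
    simp only [Ring.lie_def, mul_sub, sub_mul, mul_smul_comm, smul_mul_assoc, smul_sub]
    abel
  rw [hmode m, hsub, hLS, smul_zero, sub_zero, hmode, hmode, hsub',
    h.comm_L_L, h.comm_L_sq, add_comm m n]
  split_ifs with h0
  -- The correction $\frac1{4\eta}\cdot2\eta\cdot\frac{m^3-m}{6}$ equals $-\frac{n^3-n}{12}$ at
  -- $m=-n$, which turns $c$ into $c-1$.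
  · have hm : (m : ℂ) = -n := by
      rw [eq_neg_iff_add_eq_zero, add_comm]
      exact_mod_cast h0
    rw [hm]
    match_scalars
    · ring
    · field_simp
      ring
    · ring
  · match_scalars <;> ring

end Sugawara

-- Conjugation by the cubic residue and comparison of the currents

section FreeFields

variable {V : Type*} [AddCommGroup V] [Module ℂ V]

/-- The bracket of a residue with a field is read off from the brackets of the modes of that field
with the integrand, where the Leibniz rule applies. -/
theorem HasBracket.of_flip {A N D : VertexOperator ℂ V} {X : ℤ → VertexOperator ℂ V} {r : ℂ}
    {k : ℤ} (h : ∀ m, HasBracket (coeff A m) 1 N (X m))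
    (hD : ∀ m, coeff D m = -(r • coeff (X m) k)) : HasBracket (r • coeff N k) 1 A D := by
  intro m
  rw [hD, one_smul, mul_smul_comm, h m k, smul_mul_assoc]
  simp only [one_smul, smul_add]
  abel

theorem HasBracket.coeff_smul_left {s r : ℂ} {A B : VertexOperator ℂ V} (h : GradedComm s A B)
    (k : ℤ) : HasBracket (r • coeff A k) s B 0 := by
  intro m
  rw [coeff_zero, zero_add, smul_mul_assoc, h k m, mul_smul_comm, smul_comm]

/-- The commutation relations between the bosonic fields `a = a⁻`, `A = a⁺` and the ghosts. -/
structure IsFreeFieldSystem (η : ℂ) (a A b c ψ χ : VertexOperator ℂ V) : Prop where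
  c_c : GradedComm (-1) c c
  c_χ : GradedComm (-1) c χ
  χ_χ : GradedComm (-1) χ χ
  c_a : GradedComm 1 c a
  a_a : GradedComm 1 a a
  a_χ : GradedComm 1 a χ
  b_c : ∀ i, HasBracket (coeff b i) (-1) c (monomial V (-1 - i))
  b_a : GradedComm 1 b a
  b_χ : GradedComm (-1) b χ
  ψ_c : GradedComm (-1) ψ c
  ψ_a : GradedComm 1 ψ a
  ψ_χ : ∀ i, HasBracket (coeff ψ i) (-1) χ (monomial V (-1 - i))
  A_c : GradedComm 1 A c
  A_a : ∀ i, HasBracket (coeff A i) 1 a ((4 * η * (-(i : ℂ) - 1)) • monomial V (-2 - i))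
  A_χ : GradedComm 1 A χ

/-- The residue of `r c(z) a(z) χ(z)`. -/
def residueCubic (r : ℂ) (c a χ : VertexOperator ℂ V) : Module.End ℂ V :=
  r • coeff (normalProd (-1) c (normalProd 1 a χ)) (-1)

namespace IsFreeFieldSystem

variable {η : ℂ} {a A b c ψ χ : VertexOperator ℂ V} (h : IsFreeFieldSystem η a A b c ψ χ) (r : ℂ)

include h

theorem isLocallyNilpotent : IsLocallyNilpotent (residueCubic r c a χ) :=
  (isLocallyNilpotent_coeff_normalProd h.c_c h.c_a h.c_χ h.a_a h.a_χ h.χ_χ (-1)).smul r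

theorem hasBracket_c : HasBracket (residueCubic r c a χ) 1 c 0 := by
  refine HasBracket.coeff_smul_left (GradedComm.symm ?_ (one_mul 1)) _
  simpa using h.c_c.normalProd (h.c_a.normalProd h.c_χ (one_mul 1) 1) (by norm_num) (-1)

theorem hasBracket_a : HasBracket (residueCubic r c a χ) 1 a 0 := by
  refine HasBracket.coeff_smul_left (GradedComm.symm ?_ (one_mul 1)) _
  simpa using (h.c_a.symm (one_mul 1)).normalProd (h.a_a.normalProd h.a_χ (one_mul 1) 1)
    (one_mul 1) (-1)

theorem hasBracket_χ : HasBracket (residueCubic r c a χ) 1 χ 0 := by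
  refine HasBracket.coeff_smul_left (GradedComm.symm ?_ (one_mul 1)) _
  simpa using (h.c_χ.symm (by norm_num)).normalProd
    ((h.a_χ.symm (one_mul 1)).normalProd h.χ_χ (one_mul 1) 1) (by norm_num) (-1)

theorem hasBracket_b :
    HasBracket (residueCubic r c a χ) 1 b (-r • normalProd 1 a χ) := by
  refine HasBracket.of_flip (X := fun m ↦ shift (-1 - m) (normalProd 1 a χ)) (fun m ↦ ?_)
    fun m ↦ ?_
  · have := (h.b_c m).normalProd (((h.b_a.hasBracket m)).normalProd_zero (h.b_χ.hasBracket m)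
      (one_mul 1) 1) (by norm_num) (-1)
    simpa only [one_mul, neg_mul, mul_neg, neg_neg, mul_one, normalProd_zero_right, smul_zero,
      add_zero, normalProd_monomial_left] using this
  · rw [coeff_smul, coeff_shift, neg_smul, show -1 - (-1 - m) = m by ring]

theorem hasBracket_ψ :
    HasBracket (residueCubic r c a χ) 1 ψ (r • normalProd 1 c a) := by
  refine HasBracket.of_flip (X := fun m ↦ (-1 : ℂ) • shift (-1 - m) (normalProd 1 c a))
    (fun m ↦ ?_) fun m ↦ ?_
  · have := (h.ψ_c.hasBracket m).normalProd (((h.ψ_a.hasBracket m)).normalProd (h.ψ_χ m)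
      (one_mul 1) 1) (by norm_num) (-1)
    simpa only [one_mul, neg_mul, mul_neg, neg_neg, mul_one, normalProd_zero_left, one_smul,
      zero_add, normalProd_monomial_right, normalProd_shift_right] using this
  · rw [coeff_smul, coeff_smul, coeff_shift, show -1 - (-1 - m) = m by ring, smul_comm, neg_smul,
      one_smul, neg_neg]

/-- The mode-dependent factor $-m-1$ in $[A^{(m)},a]$ is what produces the derivative, and `hr`
removes its constant. -/
theorem hasBracket_A (hr : r * (4 * η) = 1) :
    HasBracket (residueCubic r c a χ) 1 A (deriv (normalProd (-1) c χ)) := by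
  refine HasBracket.of_flip
    (X := fun m ↦ (4 * η * (-(m : ℂ) - 1)) • shift (-2 - m) (normalProd (-1) c χ))
    (fun m ↦ ?_) fun m ↦ ?_
  · have := (h.A_c.hasBracket m).normalProd (((h.A_a m)).normalProd (h.A_χ.hasBracket m)
      (one_mul 1) 1) (one_mul 1) (-1)
    simpa only [one_mul, mul_one, normalProd_zero_left, normalProd_zero_right, one_smul, smul_zero,
      zero_add, add_zero, normalProd_smul_left, normalProd_smul_right, normalProd_monomial_left,
      normalProd_shift_right] using this
  · rw [coeff_smul, coeff_shift, show -1 - (-2 - m) = m + 1 by ring, coeff_deriv, smul_smul,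
      ← mul_assoc, hr, ← neg_smul]
    congr 1
    ring

theorem conj_c : conj (residueCubic r c a χ) c = c :=
  conj_eq_self (h.isLocallyNilpotent r) (h.hasBracket_c r)

theorem conj_b : conj (residueCubic r c a χ) b = b + -r • normalProd 1 a χ := by
  refine conj_eq_add (h.isLocallyNilpotent r) (h.hasBracket_b r) ?_
  simpa using ((h.hasBracket_a r).normalProd_zero (h.hasBracket_χ r) (one_mul 1) 1).smul (-r)

theorem conj_ψ : conj (residueCubic r c a χ) ψ = ψ + r • normalProd 1 c a := by
  refine conj_eq_add (h.isLocallyNilpotent r) (h.hasBracket_ψ r) ?_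
  simpa using ((h.hasBracket_c r).normalProd_zero (h.hasBracket_a r) (one_mul 1) 1).smul r

theorem conj_A (hr : r * (4 * η) = 1) :
    conj (residueCubic r c a χ) A = A + deriv (normalProd (-1) c χ) := by
  refine conj_eq_add (h.isLocallyNilpotent r) (h.hasBracket_A r hr) ?_
  simpa [deriv_zero] using
    ((h.hasBracket_c r).normalProd_zero (h.hasBracket_χ r) (one_mul 1) (-1)).deriv

theorem residue_ψ_deriv :
    coeff (normalProd 1 ψ (deriv (normalProd (-1) c χ))) (-1) =
      coeff (normalProd 1 c (normalProd (-1) (deriv ψ) χ)) (-1) := by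
  have hψc : GradedComm (-1) (deriv ψ) c :=
    ((h.ψ_c.symm (by norm_num)).deriv).symm (by norm_num)
  rw [residue_normalProd_deriv, normalProd_left_comm hψc (by norm_num), coeff_smul, neg_smul,
    one_smul, neg_neg]
  norm_num

/-- Of the two terms of $\partial(c\chi)$, the one with $c\,\partial\chi$ drops out because left
multiplication by $c$ anticommutes with itself (`hsq`). -/
theorem residue_ca_deriv :
    coeff (normalProd 1 (normalProd 1 c a) (deriv (normalProd (-1) c χ))) (-1) =
      coeff (normalProd 1 c (normalProd (-1) (deriv c) (normalProd 1 a χ))) (-1) := by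
  have h11 : (1 : ℂ) * 1 = 1 := one_mul 1
  have hmm : (-1 : ℂ) * -1 = 1 := by norm_num
  have hac := h.c_a.symm h11
  have hcP : GradedComm 1 (deriv (normalProd (-1) c χ)) c := by
    refine GradedComm.symm ?_ h11
    simpa using (h.c_c.normalProd h.c_χ hmm (-1)).deriv
  have haP : GradedComm 1 (deriv (normalProd (-1) c χ)) a := by
    refine GradedComm.symm ?_ h11
    simpa using (hac.normalProd h.a_χ h11 (-1)).deriv
  have hsq : ∀ X : VertexOperator ℂ V, normalProd 1 c (normalProd (-1) c X) = 0 := by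
    intro X
    refine ext_coeff fun k ↦ ?_
    have := congrArg (coeff · k) (normalProd_left_comm h.c_c hmm 1 (-1) X)
    simp only [hmm, mul_one, coeff_smul] at this
    rw [neg_smul, one_smul, eq_neg_iff_add_eq_zero, ← two_smul ℂ] at this
    rw [(smul_eq_zero.mp this).resolve_left two_ne_zero, coeff_zero]
  rw [residue_normalProd_comm h11, one_smul, normalProd_left_comm hcP h11, one_smul, h11,
    normalProd_comm haP h11, one_smul, deriv_normalProd, normalProd_add_right,
    normalProd_left_comm hac.deriv h11, normalProd_left_comm hac h11]
  simp only [one_smul, one_mul]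
  rw [normalProd_add_right, hsq, add_zero]

/-- Although $A$ and $a$ do not commute, moving $A$ next to $a$ only passes it across $c$; then
$:(\alpha+\beta)(\alpha-\beta):$ is a difference of squares as $\alpha$ and $\beta$ commute. -/
theorem residue_ca_A {α β : VertexOperator ℂ V} (ha : a = α - β) (hA : A = α + β)
    (hαβ : GradedComm 1 α β) :
    coeff (normalProd 1 (normalProd 1 c a) A) (-1) =
      coeff (normalProd 1 c (normalProd 1 α α - normalProd 1 β β)) (-1) := by
  have h11 : (1 : ℂ) * 1 = 1 := one_mul 1
  rw [residue_normalProd_comm h11, one_smul, normalProd_left_comm h.A_c h11, one_smul, h11, hA, ha,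
    normalProd_add_left, normalProd_sub_right, normalProd_sub_right, normalProd_comm hαβ h11,
    one_smul, sub_add_sub_cancel]

/-- The conjugated direct sum current and the semi-direct sum current have the same residue. -/
theorem residue_currentSemidirect {α β : VertexOperator ℂ V} (ha : a = α - β) (hA : A = α + β)
    (hαβ : GradedComm 1 α β) (hr : r * (4 * η) = 1) (T : VertexOperator ℂ V) :
    coeff (currentSemidirect T A b c ψ χ) (-1) =
      coeff (currentDirect (T - r • (normalProd 1 α α - normalProd 1 β β))
        (conj (residueCubic r c a χ) A) (conj (residueCubic r c a χ) b)
        (conj (residueCubic r c a χ) c) (conj (residueCubic r c a χ) ψ)) (-1) := by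
  rw [h.conj_c, h.conj_b, h.conj_ψ, h.conj_A r hr]
  unfold currentSemidirect currentDirect
  -- After expansion, the quadratic terms from $T$ and from $\tilde\psi\tilde A$ cancel, as do the
  -- two copies of $r\,c\,\partial c\,a\chi$.
  simp only [normalProd_add_left, normalProd_add_right, normalProd_sub_right, normalProd_smul_left,
    normalProd_smul_right, coeff_add, coeff_sub, coeff_smul, h.residue_ψ_deriv,
    h.residue_ca_deriv, h.residue_ca_A ha hA hαβ]
  module

end IsFreeFieldSystem

end FreeFields

-- Canonical anticommutation relations of the ghost modes

section GhostRelations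

theorem create_mul_create (i j : ℤ ⊕ ℤ) : create i * create j = -(create j * create i) := by
  refine LinearMap.ext fun x ↦ ?_
  simp only [create, Module.End.mul_apply, LinearMap.neg_apply, LinearMap.mulLeft_apply]
  rw [← mul_assoc, ← mul_assoc, ← neg_mul,
    eq_neg_of_add_eq_zero_left (ExteriorAlgebra.ι_add_mul_swap _ _)]

theorem annihilate_mul_annihilate (i j : ℤ ⊕ ℤ) :
    annihilate i * annihilate j = -(annihilate j * annihilate i) := by
  refine LinearMap.ext fun x ↦ ?_
  simp only [annihilate, Module.End.mul_apply, LinearMap.neg_apply]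
  exact CliffordAlgebra.contractLeft_comm _ _ _

theorem annihilate_mul_create_self (i : ℤ ⊕ ℤ) :
    annihilate i * create i = 1 - create i * annihilate i := by
  refine LinearMap.ext fun x ↦ ?_
  simp only [annihilate, create, Module.End.mul_apply, LinearMap.sub_apply,
    LinearMap.mulLeft_apply, Module.End.one_apply]
  refine (CliffordAlgebra.contractLeft_ι_mul _ _ _).trans ?_
  rw [Finsupp.lapply_apply, Finsupp.single_eq_same, one_smul]

theorem annihilate_mul_create {i j : ℤ ⊕ ℤ} (hij : i ≠ j) :
    annihilate i * create j = -(create j * annihilate i) := by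
  refine LinearMap.ext fun x ↦ ?_
  simp only [annihilate, create, Module.End.mul_apply, LinearMap.neg_apply,
    LinearMap.mulLeft_apply]
  refine (CliffordAlgebra.contractLeft_ι_mul _ _ _).trans ?_
  rw [Finsupp.lapply_apply, Finsupp.single_eq_of_ne hij, zero_smul, zero_sub]

theorem create_mul_annihilate {i j : ℤ ⊕ ℤ} (hij : i ≠ j) :
    create i * annihilate j = -(annihilate j * create i) := by
  rw [annihilate_mul_create hij.symm, neg_neg]

theorem create_mul_annihilate_self (i : ℤ ⊕ ℤ) :
    create i * annihilate i = 1 - annihilate i * create i := by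
  rw [annihilate_mul_create_self, sub_sub_cancel]

theorem cGhost_mul_cGhost (n m : ℤ) : cGhost n * cGhost m = -(cGhost m * cGhost n) := by
  unfold cGhost
  split_ifs
  · exact create_mul_create _ _
  · exact create_mul_annihilate fun h ↦ by have := Sum.inl_injective h; omega
  · exact annihilate_mul_create fun h ↦ by have := Sum.inl_injective h; omega
  · exact annihilate_mul_annihilate _ _

theorem chiGhost_mul_chiGhost (n m : ℤ) :
    chiGhost n * chiGhost m = -(chiGhost m * chiGhost n) := by
  unfold chiGhost
  split_ifs
  · exact create_mul_create _ _
  · exact create_mul_annihilate fun h ↦ by have := Sum.inr_injective h; omega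
  · exact annihilate_mul_create fun h ↦ by have := Sum.inr_injective h; omega
  · exact annihilate_mul_annihilate _ _

theorem cGhost_mul_chiGhost (n m : ℤ) : cGhost n * chiGhost m = -(chiGhost m * cGhost n) := by
  unfold cGhost chiGhost
  split_ifs
  · exact create_mul_create _ _
  · exact create_mul_annihilate Sum.inl_ne_inr
  · exact annihilate_mul_create Sum.inl_ne_inr
  · exact annihilate_mul_annihilate _ _

theorem bGhost_mul_chiGhost (n m : ℤ) : bGhost n * chiGhost m = -(chiGhost m * bGhost n) := by
  unfold bGhost chiGhost
  split_ifs
  · exact create_mul_create _ _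
  · exact create_mul_annihilate Sum.inl_ne_inr
  · exact annihilate_mul_create Sum.inl_ne_inr
  · exact annihilate_mul_annihilate _ _

theorem psiGhost_mul_cGhost (n m : ℤ) : psiGhost n * cGhost m = -(cGhost m * psiGhost n) := by
  unfold psiGhost cGhost
  split_ifs
  · exact create_mul_create _ _
  · exact create_mul_annihilate Sum.inr_ne_inl
  · exact annihilate_mul_create Sum.inr_ne_inl
  · exact annihilate_mul_annihilate _ _

theorem bGhost_mul_cGhost (n m : ℤ) :
    bGhost n * cGhost m = (if n + m = 0 then 1 else 0) - cGhost m * bGhost n := by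
  by_cases hnm : n + m = 0
  · obtain rfl : m = -n := by omega
    rw [if_pos hnm]
    unfold bGhost cGhost
    rw [neg_neg]
    -- $b_n$ and $c_{-n}$ carry the same label and exactly one of them is a creation mode, so the
    -- other two cases are void.
    split_ifs
    · omega
    · exact create_mul_annihilate_self _
    · exact annihilate_mul_create_self _
    · omega
  · rw [if_neg hnm, zero_sub]
    unfold bGhost cGhost
    split_ifs
    · exact create_mul_create _ _
    · exact create_mul_annihilate fun h ↦ by have := Sum.inl_injective h; omega
    · exact annihilate_mul_create fun h ↦ by have := Sum.inl_injective h; omega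
    · exact annihilate_mul_annihilate _ _

theorem psiGhost_mul_chiGhost (n m : ℤ) :
    psiGhost n * chiGhost m = (if n + m = 0 then 1 else 0) - chiGhost m * psiGhost n := by
  by_cases hnm : n + m = 0
  · obtain rfl : m = -n := by omega
    rw [if_pos hnm]
    unfold psiGhost chiGhost
    split_ifs
    · omega
    · exact create_mul_annihilate_self _
    · exact annihilate_mul_create_self _
    · omega
  · rw [if_neg hnm, zero_sub]
    unfold psiGhost chiGhost
    split_ifs
    · exact create_mul_create _ _
    · exact create_mul_annihilate fun h ↦ by have := Sum.inr_injective h; omega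
    · exact annihilate_mul_create fun h ↦ by have := Sum.inr_injective h; omega
    · exact annihilate_mul_annihilate _ _

end GhostRelations

-- The combinations $a^\pm$ of two Heisenberg fields of opposite level

section LightCone

variable {V : Type*} [AddCommGroup V] [Module ℂ V]

theorem gradedComm_neg_one {A B : VertexOperator ℂ V}
    (h : ∀ i j, coeff A i * coeff B j = -(coeff B j * coeff A i)) : GradedComm (-1) A B :=
  fun i j ↦ by rw [h, neg_smul, one_smul]

theorem hasBracket_neg_one {X : Module.End ℂ V} {A A' : VertexOperator ℂ V}
    (h : ∀ k, X * coeff A k = coeff A' k - coeff A k * X) : HasBracket X (-1) A A' :=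
  fun k ↦ by rw [h, neg_smul, one_smul, sub_eq_add_neg]

variable {c c' η η' : ℂ} {T T' α β : VertexOperator ℂ V}

theorem IsW2.mul_coeff_a (h : IsW2 c η T α) (i j : ℤ) :
    coeff α i * coeff α j = coeff α j * coeff α i +
      (2 * η * (-(i : ℂ) - 1)) • coeff (monomial V (-2 - i)) j := by
  have := h.hasBracket_a (-i - 1) j
  rw [← coeff_eq_mode, coeff_smul, one_smul, show -i - 1 - 1 = -2 - i by ring, add_comm] at this
  rw [this]
  push_cast
  rfl

theorem IsW2.gradedComm_sub (h : IsW2 c η T α) (h' : IsW2 c' η' T' β) (hηη' : η + η' = 0)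
    (hαβ : GradedComm 1 α β) : GradedComm 1 (α - β) (α - β) := by
  intro i j
  have h1 := hαβ i j
  have h2 := hαβ j i
  rw [one_smul] at h1 h2
  rw [coeff_sub, coeff_sub, one_smul, sub_mul, mul_sub, mul_sub, sub_mul, mul_sub, mul_sub,
    h.mul_coeff_a, h'.mul_coeff_a, h1, h2, eq_neg_of_add_eq_zero_right hηη']
  module

/-- The levels $2\eta$ and $2\bar\eta=-2\eta$ enter with opposite signs here and add up to $4\eta$,
whereas for $a^-$ with itself they cancel. -/
theorem IsW2.hasBracket_add_sub (h : IsW2 c η T α) (h' : IsW2 c' η' T' β) (hηη' : η + η' = 0)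
    (hαβ : GradedComm 1 α β) (i : ℤ) :
    HasBracket (coeff (α + β) i) 1 (α - β)
      ((4 * η * (-(i : ℂ) - 1)) • monomial V (-2 - i)) := by
  intro j
  have h1 := hαβ i j
  have h2 := hαβ j i
  rw [one_smul] at h1 h2
  rw [coeff_add, coeff_sub, one_smul, coeff_smul, add_mul, mul_sub, mul_sub, sub_mul, mul_add,
    mul_add, h.mul_coeff_a, h'.mul_coeff_a, h1, h2, eq_neg_of_add_eq_zero_right hηη']
  module

theorem decoupled_add_decoupled (hηη' : η + η' = 0) :
    decoupled η T α + decoupled η' T' β =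
      T + T' - (1 / (4 * η)) • (normalProd 1 α α - normalProd 1 β β) := by
  refine ext_coeff fun k ↦ ?_
  rw [decoupled, decoupled, eq_neg_of_add_eq_zero_right hηη', mul_neg, div_neg]
  simp only [coeff_add, coeff_sub, coeff_smul]
  module

theorem residue_eq (A : VertexOperator ℂ V) :
    (2 * Real.pi * Complex.I : ℂ)⁻¹ • contourIntegral A = coeff A (-1) := by
  have hπ : (Real.pi : ℂ) ≠ 0 := by exact_mod_cast Real.pi_ne_zero
  rw [contourIntegral, smul_smul, inv_mul_cancel₀, one_smul]
  exact mul_ne_zero (mul_ne_zero two_ne_zero hπ) Complex.I_ne_zero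

end LightCone

-- Relations between the fields on the tensor product complex

section FieldRelations

variable {W W' : Type*} [AddCommGroup W] [Module ℂ W] [AddCommGroup W'] [Module ℂ W']

theorem coeff_fieldLeft (h : ℤ) (A : ℤ → Module.End ℂ W) (hA : IsSmooth A) (k : ℤ) :
    coeff (fieldLeft W W' h A hA) k = ((A (-k - h)).rTensor W').rTensor GhostFock := rfl

theorem coeff_fieldRight (h : ℤ) (A : ℤ → Module.End ℂ W') (hA : IsSmooth A) (k : ℤ) :
    coeff (fieldRight W W' h A hA) k = ((A (-k - h)).lTensor W).rTensor GhostFock := rfl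

theorem coeff_fieldGhost (h : ℤ) (A : ℤ → Module.End ℂ GhostFock) (hA : IsSmooth A) (k : ℤ) :
    coeff (fieldGhost W W' h A hA) k = (A (-k - h)).lTensor (W ⊗[ℂ] W') := rfl

theorem gradedComm_fieldGhost {A B : ℤ → Module.End ℂ GhostFock} (hA : IsSmooth A)
    (hB : IsSmooth B) (h h' : ℤ) (hAB : ∀ n m, A n * B m = -(B m * A n)) :
    GradedComm (-1) (fieldGhost W W' h A hA) (fieldGhost W W' h' B hB) := by
  refine gradedComm_neg_one fun i j ↦ ?_
  rw [coeff_fieldGhost, coeff_fieldGhost, ← LinearMap.lTensor_mul, hAB, LinearMap.lTensor_neg,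
    LinearMap.lTensor_mul]

/-- Conjugate ghosts have weights adding up to one, which places the contraction in degree $-1-i$.
-/
theorem hasBracket_fieldGhost {A B : ℤ → Module.End ℂ GhostFock} (hA : IsSmooth A)
    (hB : IsSmooth B) {h h' : ℤ} (hh : h + h' = 1)
    (hAB : ∀ n m, A n * B m = (if n + m = 0 then 1 else 0) - B m * A n) (i : ℤ) :
    HasBracket (coeff (fieldGhost W W' h A hA) i) (-1) (fieldGhost W W' h' B hB)
      (monomial (SemiInfComplex W W') (-1 - i)) := by
  refine hasBracket_neg_one fun j ↦ ?_
  rw [coeff_fieldGhost, coeff_fieldGhost, ← LinearMap.lTensor_mul, hAB, LinearMap.lTensor_sub,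
    LinearMap.lTensor_mul, coeff_monomial]
  congr 1
  by_cases hj : j = -1 - i
  · rw [if_pos hj, if_pos (by omega)]
    exact LinearMap.lTensor_id _ _
  · rw [if_neg hj, if_neg (by omega)]
    exact LinearMap.lTensor_zero _

theorem gradedComm_fieldGhost_fieldLeft {A : ℤ → Module.End ℂ GhostFock} (hA : IsSmooth A)
    {B : ℤ → Module.End ℂ W} (hB : IsSmooth B) (h h' : ℤ) :
    GradedComm 1 (fieldGhost W W' h A hA) (fieldLeft W W' h' B hB) := fun i j ↦ by
  rw [coeff_fieldGhost, coeff_fieldLeft, one_smul, Module.End.mul_eq_comp, Module.End.mul_eq_comp,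
    LinearMap.lTensor_comp_rTensor, LinearMap.rTensor_comp_lTensor]

theorem gradedComm_fieldGhost_fieldRight {A : ℤ → Module.End ℂ GhostFock} (hA : IsSmooth A)
    {B : ℤ → Module.End ℂ W'} (hB : IsSmooth B) (h h' : ℤ) :
    GradedComm 1 (fieldGhost W W' h A hA) (fieldRight W W' h' B hB) := fun i j ↦ by
  rw [coeff_fieldGhost, coeff_fieldRight, one_smul, Module.End.mul_eq_comp, Module.End.mul_eq_comp,
    LinearMap.lTensor_comp_rTensor, LinearMap.rTensor_comp_lTensor]

theorem gradedComm_fieldLeft_fieldRight {A : ℤ → Module.End ℂ W} (hA : IsSmooth A)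
    {B : ℤ → Module.End ℂ W'} (hB : IsSmooth B) (h h' : ℤ) :
    GradedComm 1 (fieldLeft W W' h A hA) (fieldRight W W' h' B hB) := fun i j ↦ by
  rw [coeff_fieldLeft, coeff_fieldRight, one_smul, ← LinearMap.rTensor_mul,
    ← LinearMap.rTensor_mul, Module.End.mul_eq_comp, Module.End.mul_eq_comp,
    LinearMap.lTensor_comp_rTensor, LinearMap.rTensor_comp_lTensor]

theorem mode_fieldLeft (h : ℤ) (A : ℤ → Module.End ℂ W) (hA : IsSmooth A) (n : ℤ) :
    mode h (fieldLeft W W' h A hA) n = ((A n).rTensor W').rTensor GhostFock := by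
  rw [mode_def, coeff_fieldLeft, neg_sub, sub_neg_eq_add, add_sub_cancel_left]

theorem mode_fieldRight (h : ℤ) (A : ℤ → Module.End ℂ W') (hA : IsSmooth A) (n : ℤ) :
    mode h (fieldRight W W' h A hA) n = ((A n).lTensor W).rTensor GhostFock := by
  rw [mode_def, coeff_fieldRight, neg_sub, sub_neg_eq_add, add_sub_cancel_left]

theorem isW2_left {c η : ℂ} (ρ : W2Module c η W) :
    IsW2 (V := SemiInfComplex W W') c η (LField ρ) (aField ρ) := by
  have hlie : ∀ f g : Module.End ℂ W, ⁅(f.rTensor W').rTensor GhostFock,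
      (g.rTensor W').rTensor GhostFock⁆ = (⁅f, g⁆.rTensor W').rTensor GhostFock := by
    intro f g
    simp only [Ring.lie_def, LinearMap.rTensor_sub, LinearMap.rTensor_mul]
  have hone : ((1 : Module.End ℂ W).rTensor W').rTensor GhostFock = 1 := by
    rw [Module.End.one_eq_id, LinearMap.rTensor_id, LinearMap.rTensor_id]; rfl
  refine ⟨fun n m ↦ ?_, fun n m ↦ ?_, fun n m ↦ ?_⟩
  · unfold LField
    rw [mode_fieldLeft, mode_fieldLeft, mode_fieldLeft, hlie, ρ.comm_L_L]
    simp only [LinearMap.rTensor_add, LinearMap.rTensor_smul, hone]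
  · unfold aField
    rw [mode_fieldLeft, mode_fieldLeft, hlie, ρ.comm_a_a]
    simp only [LinearMap.rTensor_smul, hone]
  · unfold LField aField
    rw [mode_fieldLeft, mode_fieldLeft, mode_fieldLeft, hlie, ρ.comm_L_a]
    simp only [LinearMap.rTensor_smul]

theorem isW2_right {c η : ℂ} (ρ : W2Module c η W') :
    IsW2 (V := SemiInfComplex W W') c η (LbarField ρ) (abarField ρ) := by
  have hlie : ∀ f g : Module.End ℂ W', ⁅(f.lTensor W).rTensor GhostFock,
      (g.lTensor W).rTensor GhostFock⁆ = (⁅f, g⁆.lTensor W).rTensor GhostFock := by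
    intro f g
    simp only [Ring.lie_def, LinearMap.rTensor_sub, LinearMap.rTensor_mul, LinearMap.lTensor_sub,
      LinearMap.lTensor_mul]
  have hone : ((1 : Module.End ℂ W').lTensor W).rTensor GhostFock = 1 := by
    rw [Module.End.one_eq_id, LinearMap.lTensor_id, LinearMap.rTensor_id]; rfl
  refine ⟨fun n m ↦ ?_, fun n m ↦ ?_, fun n m ↦ ?_⟩
  · unfold LbarField
    rw [mode_fieldRight, mode_fieldRight, mode_fieldRight, hlie, ρ.comm_L_L]
    simp only [LinearMap.lTensor_add, LinearMap.lTensor_smul, LinearMap.rTensor_add,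
      LinearMap.rTensor_smul, hone]
  · unfold abarField
    rw [mode_fieldRight, mode_fieldRight, hlie, ρ.comm_a_a]
    simp only [LinearMap.lTensor_smul, LinearMap.rTensor_smul, hone]
  · unfold LbarField abarField
    rw [mode_fieldRight, mode_fieldRight, mode_fieldRight, hlie, ρ.comm_L_a]
    simp only [LinearMap.lTensor_smul, LinearMap.rTensor_smul]

theorem isFreeFieldSystem {c c' η η' : ℂ} (hηη' : η + η' = 0) (ρ : W2Module c η W)
    (ρ' : W2Module c' η' W') :
    IsFreeFieldSystem η (aMinus ρ ρ') (aPlus ρ ρ') (bField W W') (cField W W') (psiField W W')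
      (chiField W W') := by
  have hlr : GradedComm 1 (aField (W' := W') ρ) (abarField (W := W) ρ') :=
    gradedComm_fieldLeft_fieldRight _ _ _ _
  have hminus : ∀ {h : ℤ} {A : ℤ → Module.End ℂ GhostFock} (hA : IsSmooth A),
      GradedComm 1 (fieldGhost W W' h A hA) (aMinus ρ ρ') := fun hA ↦
    (gradedComm_fieldGhost_fieldLeft hA _ _ _).sub (gradedComm_fieldGhost_fieldRight hA _ _ _)
  have hplus : ∀ {h : ℤ} {A : ℤ → Module.End ℂ GhostFock} (hA : IsSmooth A),
      GradedComm 1 (fieldGhost W W' h A hA) (aPlus ρ ρ') := fun hA ↦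
    (gradedComm_fieldGhost_fieldLeft hA _ _ _).add (gradedComm_fieldGhost_fieldRight hA _ _ _)
  exact
    { c_c := gradedComm_fieldGhost _ _ _ _ cGhost_mul_cGhost
      c_χ := gradedComm_fieldGhost _ _ _ _ cGhost_mul_chiGhost
      χ_χ := gradedComm_fieldGhost _ _ _ _ chiGhost_mul_chiGhost
      c_a := hminus _
      a_a := (isW2_left ρ).gradedComm_sub (isW2_right ρ') hηη' hlr
      a_χ := (hminus _).symm (one_mul 1)
      b_c := hasBracket_fieldGhost _ _ (by norm_num) bGhost_mul_cGhost
      b_a := hminus _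
      b_χ := gradedComm_fieldGhost _ _ _ _ bGhost_mul_chiGhost
      ψ_c := gradedComm_fieldGhost _ _ _ _ psiGhost_mul_cGhost
      ψ_a := hminus _
      ψ_χ := hasBracket_fieldGhost _ _ (by norm_num) psiGhost_mul_chiGhost
      A_c := (hplus _).symm (one_mul 1)
      A_a := (isW2_left ρ).hasBracket_add_sub (isW2_right ρ') hηη' hlr
      A_χ := (hplus _).symm (one_mul 1) }

theorem conjR_eq {c c' η η' : ℂ} (ρ : W2Module c η W) (ρ' : W2Module c' η' W') :
    conjR ρ ρ' = residueCubic (1 / (4 * η)) (cField W W') (aMinus ρ ρ') (chiField W W') := by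
  have hπ : (Real.pi : ℂ) ≠ 0 := by exact_mod_cast Real.pi_ne_zero
  have hI := Complex.I_ne_zero
  rw [conjR, contourIntegral, residueCubic, smul_smul]
  congr 1
  -- At $\eta=0$ both scalars are zero by the convention for inverses; otherwise $2\pi i/(8\eta\pi
  -- i)=1/(4\eta)$.
  by_cases hη : η = 0
  · simp [hη]
  · field_simp
    norm_num

end FieldRelations

end W2BRST

end

-- The main theorem

theorem proposition3p5 {W W' : Type*} [AddCommGroup W] [Module ℂ W] [AddCommGroup W'] [Module ℂ W']
    (c c' η η' : ℂ) (hη : η ≠ 0) (hc : c + c' = 28) (hηη' : η + η' = 0)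
    (ρ : W2BRST.W2Module c η W) (ρ' : W2BRST.W2Module c' η' W') :
    W2BRST.IsLocallyNilpotent (W2BRST.conjR ρ ρ') ∧
    W2BRST.brst ρ ρ' =
      (2 * Real.pi * Complex.I : ℂ)⁻¹ • W2BRST.contourIntegral
        (W2BRST.currentDirect
          (W2BRST.LDecoupled ρ + W2BRST.LbarDecoupled ρ')
          (W2BRST.conj (W2BRST.conjR ρ ρ') (W2BRST.aPlus ρ ρ'))
          (W2BRST.conj (W2BRST.conjR ρ ρ') (W2BRST.bField W W'))
          (W2BRST.conj (W2BRST.conjR ρ ρ') (W2BRST.cField W W'))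
          (W2BRST.conj (W2BRST.conjR ρ ρ') (W2BRST.psiField W W'))) ∧
    W2BRST.IsVirasoroHeisenberg (V := W2BRST.SemiInfComplex W W') (c - 1) η
      (W2BRST.LDecoupled ρ) (W2BRST.aField ρ) ∧
    W2BRST.IsVirasoroHeisenberg (V := W2BRST.SemiInfComplex W W') (c' - 1) η'
      (W2BRST.LbarDecoupled ρ') (W2BRST.abarField ρ') := by
  have hsys := W2BRST.isFreeFieldSystem hηη' ρ ρ'
  have hη' : η' ≠ 0 := by rw [eq_neg_of_add_eq_zero_right hηη']; exact neg_ne_zero.mpr hη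
  refine ⟨?_, ?_, (W2BRST.isW2_left ρ).isVirasoroHeisenberg hη,
    (W2BRST.isW2_right ρ').isVirasoroHeisenberg hη'⟩
  · rw [W2BRST.conjR_eq]
    exact hsys.isLocallyNilpotent _
  · rw [W2BRST.brst, W2BRST.residue_eq, W2BRST.residue_eq, W2BRST.conjR_eq,
      hsys.residue_currentSemidirect (1 / (4 * η)) rfl rfl
        (W2BRST.gradedComm_fieldLeft_fieldRight _ _ _ _) (by field_simp),
      W2BRST.LDecoupled, W2BRST.LbarDecoupled, W2BRST.decoupled_add_decoupled hηη']
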